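/- Let $H$ be a complex separable infinite-dimensional Hilbert space, let $T_1,T_2\in B(H)$ commute and let $\varphi\in H$. Let $R_1,R_2$ be the right shifts on $\ell^2(\mathbb N_0\times\mathbb N_0)$ in the first and in the second component. Let $U$, $U(c)=\sum_{i,j\ge 0}c_{ij}T_1^iT_2^j\varphi$, be the synthesis operator of $\{T_1^iT_2^j\varphi\}_{i,j\ge 0}$, defined for those $c\in\ell^2(\mathbb N_0\times\mathbb N_0)$ for which the series converges unconditionally. Assume that $R_1,R_2$ doubly commute on $\operatorname{Ker}(U)$: with $N=\overline{\operatorname{Ker}(U)}$ (which equals $\operatorname{Ker}(U)$ if the system is a frame), $R_1$ and $R_2$ map $N$ to itself, and the operators $A_1=R_1|_N$, $A_2=R_2|_N$ on the Hilbert space $N$ satisfy $A_1A_2=A_2A_1$ and $A_1A_2^*=A_2^*A_1$. Let $H^2(\mathbb T^2)$ be the space of all $f\in L^2(\mathbb T^2)$ (normalized Haar measure $\mu$) with $\int f\,\bar z^m\bar w^n\,d\mu=0$ whenever $m<0$ or $n<0$, and let $S_z,S_w$ be multiplication by $z$ and by $w$ on it. An inner function is a $\phi\in H^2(\mathbb T^2)$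 with $|\phi|=1$ almost everywhere. For an inner function $\phi$ let $K_\phi=H^2(\mathbb T^2)\ominus\phi H^2(\mathbb T^2)$, let $P_{K_\phi}$ be the orthogonal projection onto $K_\phi$, and let $S_{K_\phi,z}=P_{K_\phi}S_z|_{K_\phi}$, $S_{K_\phi,w}=P_{K_\phi}S_w|_{K_\phi}$. Then the following are equivalent. 1. $\{T_1^iT_2^j\varphi\}_{i,j\ge 0}$ is an overcomplete frame for $H$, that is, there are $0<C_1\le C_2$ with $C_1\|x\|^2\le\sum_{i,j}|\langle x,T_1^iT_2^j\varphi\rangle|^2\le C_2\|x\|^2$ for all $x\in H$, and the expansions $x=\sum_{i,j}c_{ij}T_1^iT_2^j\varphi$ with $c\in\ell^2(\mathbb N_0\times\mathbb N_0)$ are not unique. 2. There is an inner function $\phi$ with $\phi H^2(\mathbb T^2)\neq H^2(\mathbb T^2)$ such that $(T_1,T_2,\varphi)\cong(S_{K_\phi,z},S_{K_\phi,w},P_{K_\phi}1)$, that is, there is a bounded invertible operator $L:H\to K_\phi$ with $LT_1L^{-1}=S_{K_\phi,z}$, $LT_2L^{-1}=S_{K_\phi,w}$ and $L\varphi=P_{K_\phi}1$;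 and $\phi$ is unique up to a unimodular constant: every inner function $\psi$ with $\psi H^2(\mathbb T^2)\neq H^2(\mathbb T^2)$ and $(T_1,T_2,\varphi)\cong(S_{K_\psi,z},S_{K_\psi,w},P_{K_\psi}1)$ is of the form $\psi=c\phi$ with $c\in\mathbb C$, $|c|=1$. -/

import Mathlib

open MeasureTheory UnitAddTorus
open scoped ENNReal

noncomputable section

namespace BidiscFrames

/-! ### Frames and synthesis operators -/

section Frames

variable {ι H : Type*} [NormedAddCommGroup H] [InnerProductSpace ℂ H]

/-- The family `f` is a frame for `H`: there are `0 < C₁ ≤ C₂` with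
`C₁ ‖x‖² ≤ ∑ᵢ |⟨x, fᵢ⟩|² ≤ C₂ ‖x‖²` for every `x`. -/
def IsFrame (f : ι → H) : Prop :=
  ∃ C₁ C₂ : ℝ, 0 < C₁ ∧ C₁ ≤ C₂ ∧ ∀ x : H,
    Summable (fun i => ‖inner ℂ (f i) x‖ ^ 2) ∧
    C₁ * ‖x‖ ^ 2 ≤ ∑' i, ‖inner ℂ (f i) x‖ ^ 2 ∧
    ∑' i, ‖inner ℂ (f i) x‖ ^ 2 ≤ C₂ * ‖x‖ ^ 2

/-- The space `ℓ²(ι)` of complex square summable families. -/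
abbrev ell2 (ι : Type*) : Type _ := lp (fun _ : ι => ℂ) 2

/-- An overcomplete frame: a frame for which the expansions `x = ∑ᵢ cᵢ fᵢ` with `c ∈ ℓ²` are not
unique. -/
def IsOvercompleteFrame (f : ι → H) : Prop :=
  IsFrame f ∧ ∃ (x : H) (c d : ell2 ι), c ≠ d ∧
    HasSum (fun i => c i • f i) x ∧ HasSum (fun i => d i • f i) x

/-- The synthesis operator `c ↦ ∑ᵢ cᵢ fᵢ` of an arbitrary family `f`, as a partially defined
operator on `ℓ²` whose domain is the set of all `c ∈ ℓ²` for which the series converges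
unconditionally. If `f` is a frame, this is all of `ℓ²`. -/
def synthesis (f : ι → H) : ell2 ι →ₗ.[ℂ] H where
  domain :=
    { carrier := {c | Summable fun i => c i • f i}
      add_mem' := fun {c d} hc hd => by
        simpa [add_smul] using Summable.add hc hd
      zero_mem' := by simp
      smul_mem' := fun a c hc => by
        simpa [mul_smul] using Summable.const_smul a hc }
  toFun :=
    { toFun := fun c => ∑' i, (c : ell2 ι) i • f i
      map_add' := fun c d => by
        simp only [Submodule.coe_add, lp.coeFn_add, Pi.add_apply, add_smul]
        exact c.2.tsum_add d.2
      map_smul' := fun a c => by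
        simp only [Submodule.coe_smul, lp.coeFn_smul, Pi.smul_apply, smul_eq_mul, mul_smul,
          RingHom.id_apply]
        exact c.2.tsum_const_smul a }

/-- The kernel of the synthesis operator, as a subspace of `ℓ²`. -/
def synthesisKernel (f : ι → H) : Submodule ℂ (ell2 ι) :=
  (LinearMap.ker (synthesis f).toFun).map (synthesis f).domain.subtype

/-- The system `{T₁ⁱ T₂ʲ φ}`, indexed by `(i, j) ∈ ℕ × ℕ`. -/
def orbit (T₁ T₂ : H →L[ℂ] H) (φ : H) : ℕ × ℕ → H :=
  fun p => (T₁ ^ p.1) ((T₂ ^ p.2) φ)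

end Frames

/-! ### Right shifts on `ℓ²(ℕ × ℕ)` and doubly commuting operators -/

section Shifts

/-- For an injective map `e` of the index set, the isometry of `ℓ²(ι)` that moves the entry at `i`
to the position `e i` and puts zeros at the positions outside the range of `e`. -/
def pushforward {ι : Type*} (e : ι ↪ ι) : ell2 ι →ₗᵢ[ℂ] ell2 ι where
  toFun c := ⟨Function.extend e c 0, by
    have hc := (lp.memℓp c).summable (by norm_num)
    refine memℓp_gen ?_
    have h : (fun i => ‖Function.extend e c 0 i‖ ^ (2 : ℝ≥0∞).toReal) =
        Function.extend e (fun i => ‖c i‖ ^ (2 : ℝ≥0∞).toReal) 0 := by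
      funext i
      by_cases hi : ∃ j, e j = i
      · obtain ⟨j, rfl⟩ := hi
        simp [e.injective.extend_apply]
      · simp [Function.extend_apply' _ _ _ hi]
    rw [h]
    exact (summable_extend_zero e.injective).2 hc⟩
  map_add' c d := by
    ext i
    change Function.extend e (⇑c + ⇑d) 0 i = Function.extend e c 0 i + Function.extend e d 0 i
    by_cases hi : ∃ j, e j = i
    · obtain ⟨j, rfl⟩ := hi
      simp only [e.injective.extend_apply, Pi.add_apply]
    · simp only [Function.extend_apply' _ _ _ hi, Pi.zero_apply, add_zero]
  map_smul' a c := by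
    ext i
    by_cases hi : ∃ j, e j = i
    · obtain ⟨j, rfl⟩ := hi
      simp [e.injective.extend_apply]
    · simp [Function.extend_apply' _ _ _ hi]
  norm_map' c := by
    have hp : 0 < (2 : ℝ≥0∞).toReal := by norm_num
    rw [lp.norm_eq_tsum_rpow hp, lp.norm_eq_tsum_rpow hp]
    congr 1
    have h : (fun i => ‖Function.extend e c 0 i‖ ^ (2 : ℝ≥0∞).toReal) =
        Function.extend e (fun i => ‖c i‖ ^ (2 : ℝ≥0∞).toReal) 0 := by
      funext i
      by_cases hi : ∃ j, e j = i
      · obtain ⟨j, rfl⟩ := hi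
        simp [e.injective.extend_apply]
      · simp [Function.extend_apply' _ _ _ hi]
    exact (congrArg tsum h).trans (tsum_extend_zero e.injective _)

/-- The right shift in the first component: `(R₁ c)(i + 1, j) = c(i, j)`, `(R₁ c)(0, j) = 0`. -/
def R₁ : ell2 (ℕ × ℕ) →L[ℂ] ell2 (ℕ × ℕ) :=
  (pushforward ⟨fun p => (p.1 + 1, p.2), fun p q h => by
    simpa [Prod.ext_iff] using h⟩).toContinuousLinearMap

/-- The right shift in the second component: `(R₂ c)(i, j + 1) = c(i, j)`, `(R₂ c)(i, 0) = 0`. -/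
def R₂ : ell2 (ℕ × ℕ) →L[ℂ] ell2 (ℕ × ℕ) :=
  (pushforward ⟨fun p => (p.1, p.2 + 1), fun p q h => by
    simpa [Prod.ext_iff] using h⟩).toContinuousLinearMap

/-- Operators on a Hilbert space doubly commute: `V₁` commutes with `V₂` and with `V₂*`. -/
def DoublyCommute {E : Type*} [NormedAddCommGroup E] [InnerProductSpace ℂ E] [CompleteSpace E]
    (V₁ V₂ : E →L[ℂ] E) : Prop :=
  Commute V₁ V₂ ∧ Commute V₁ (ContinuousLinearMap.adjoint V₂)

/-- `V₁, V₂` doubly commute on the subspace `N`: both map `N` to itself, and their restrictions,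
as operators on the Hilbert space `N`, doubly commute (the adjoint being taken in `N`). For a
subspace that is not closed, its closure takes the place of `N`. -/
def DoublyCommuteOn {E : Type*} [NormedAddCommGroup E] [InnerProductSpace ℂ E] [CompleteSpace E]
    (V₁ V₂ : E →L[ℂ] E) (N : Submodule ℂ E) : Prop :=
  ∃ (h₁ : ∀ x ∈ N.topologicalClosure, V₁ x ∈ N.topologicalClosure)
    (h₂ : ∀ x ∈ N.topologicalClosure, V₂ x ∈ N.topologicalClosure),
    DoublyCommute (V₁.restrict h₁) (V₂.restrict h₂)

end Shifts

/-! ### The Hardy space of the two-dimensional torus -/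

section Hardy

/-- The torus `𝕋²`, with coordinates `t ∈ (ℝ / ℤ)²`; the variables are `z = exp (2πi t₀)` and
`w = exp (2πi t₁)`, and the monomial `z ^ m * w ^ n` is `mFourier ![m, n]`. -/
abbrev Torus2 : Type := UnitAddTorus (Fin 2)

/-- The normalized Haar measure of `𝕋²`. -/
abbrev torusMeasure : Measure Torus2 :=
  Measure.pi fun _ : Fin 2 => AddCircle.haarAddCircle

/-- `L²(𝕋²)`. -/
abbrev L2Torus : Type := Lp ℂ 2 torusMeasure

/-- `L²` Fourier coefficients, through the Fourier basis of Mathlib. -/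
theorem fourierBasis_repr (f : L2Torus) (n : Fin 2 → ℤ) :
    (mFourierBasis (d := Fin 2)).repr f n = mFourierCoeff f n :=
  mFourierBasis_repr f n

/-- `H²(𝕋²)`: the functions in `L²(𝕋²)` whose Fourier coefficients `∫ f z̄ᵐ w̄ⁿ dμ` vanish
whenever `m < 0` or `n < 0`. -/
def hardy : Submodule ℂ L2Torus where
  carrier := {f | ∀ n : Fin 2 → ℤ, n 0 < 0 ∨ n 1 < 0 → mFourierCoeff f n = 0}
  add_mem' := fun {f g} hf hg n hn => by
    have h1 := hf n hn
    have h2 := hg n hn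
    rw [← fourierBasis_repr] at h1 h2 ⊢
    exact (congrArg (fun u => u n) (map_add (mFourierBasis (d := Fin 2)).repr f g)).trans
      ((congrArg₂ (· + ·) h1 h2).trans (add_zero 0))
  zero_mem' := fun n _ => by
    rw [← fourierBasis_repr]
    exact congrArg (fun u => u n) (map_zero (mFourierBasis (d := Fin 2)).repr)
  smul_mem' := fun a f hf n hn => by
    have h1 := hf n hn
    rw [← fourierBasis_repr] at h1 ⊢
    exact (congrArg (fun u => u n) (map_smul (mFourierBasis (d := Fin 2)).repr a f)).trans
      ((congrArg (a * ·) h1).trans (mul_zero a))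

theorem isClosed_hardy : IsClosed (hardy : Set L2Torus) := by
  have h : (hardy : Set L2Torus) = ⋂ (n : Fin 2 → ℤ) (_ : n 0 < 0 ∨ n 1 < 0),
      {f | inner ℂ (mFourierBasis (d := Fin 2) n) f = 0} := by
    ext f
    simp only [Set.mem_iInter]
    refine forall₂_congr fun n _ => ?_
    rw [← fourierBasis_repr, HilbertBasis.repr_apply_apply]
    exact Iff.rfl
  rw [h]
  refine isClosed_iInter fun n => isClosed_iInter fun _ => ?_
  exact isClosed_eq (continuous_const.inner continuous_id) continuous_const

/-- The Hardy space `H²(𝕋²)` as a Hilbert space. -/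
abbrev H2 : Type := hardy

instance : CompleteSpace H2 := isClosed_hardy.completeSpace_coe

/-- Multiplication by the monomial `mFourier m` on `L²(𝕋²)`. -/
def mulMonomial (m : Fin 2 → ℤ) : L2Torus →L[ℂ] L2Torus :=
  (ContinuousLinearMap.mul ℂ ℂ).holderL torusMeasure ∞ 2 2 (mFourierLp ∞ m)

theorem coeFn_mulMonomial (m : Fin 2 → ℤ) (f : L2Torus) :
    mulMonomial m f =ᵐ[torusMeasure] fun x => mFourier m x * f x := by
  have h1 := (ContinuousLinearMap.mul ℂ ℂ).coeFn_holder (r := 2)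
    (mFourierLp ∞ m : Lp ℂ ∞ torusMeasure) f
  have h2 : mFourierLp ∞ m =ᵐ[torusMeasure] mFourier m := coeFn_mFourierLp ∞ m
  filter_upwards [h1, h2] with x hx hx2
  exact hx.trans (by rw [hx2]; rfl)

theorem mFourierCoeff_mulMonomial (m n : Fin 2 → ℤ) (f : L2Torus) :
    mFourierCoeff (mulMonomial m f) n = mFourierCoeff f (n - m) := by
  refine integral_congr_ae ?_
  filter_upwards [coeFn_mulMonomial m f] with x hx
  rw [hx, neg_sub, sub_eq_neg_add, mFourier_add]
  simp only [smul_eq_mul, mul_assoc]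

/-- Multiplication by the `i`-th coordinate function maps `H²(𝕋²)` to itself. -/
theorem mulMonomial_single_mem (i : Fin 2) :
    ∀ f ∈ hardy, mulMonomial (Pi.single i 1) f ∈ hardy := by
  intro f hf n hn
  rw [mFourierCoeff_mulMonomial]
  refine hf _ ?_
  fin_cases i <;> simp <;> omega

/-- The shift `S_z`: multiplication by `z` on `H²(𝕋²)`. -/
def Sz : H2 →L[ℂ] H2 := (mulMonomial (Pi.single 0 1)).restrict (mulMonomial_single_mem 0)

/-- The shift `S_w`: multiplication by `w` on `H²(𝕋²)`. -/
def Sw : H2 →L[ℂ] H2 := (mulMonomial (Pi.single 1 1)).restrict (mulMonomial_single_mem 1)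

theorem const_one_mem : (Lp.const 2 torusMeasure (1 : ℂ) : L2Torus) ∈ hardy := by
  intro n hn
  have h : (Lp.const 2 torusMeasure (1 : ℂ) : L2Torus) = mFourierBasis (d := Fin 2) 0 := by
    rw [coe_mFourierBasis]
    refine Lp.ext ?_
    have h2 : mFourierLp 2 0 =ᵐ[torusMeasure] mFourier 0 := coeFn_mFourierLp 2 0
    filter_upwards [Lp.coeFn_const 2 torusMeasure (1 : ℂ), h2] with x hx hx2
    rw [hx]
    exact (hx2.trans (by rw [mFourier_zero]; rfl)).symm
  rw [← fourierBasis_repr, h, HilbertBasis.repr_apply_apply,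
    orthonormal_iff_ite.1 (mFourierBasis (d := Fin 2)).orthonormal, if_neg]
  rintro rfl
  simp at hn

/-- The constant function `1` in `H²(𝕋²)`. -/
def one : H2 := ⟨Lp.const 2 torusMeasure (1 : ℂ), const_one_mem⟩

/-- An inner function in `H²(𝕋²)`: an element of modulus one almost everywhere. -/
def IsInner (θ : H2) : Prop :=
  ∀ᵐ x ∂torusMeasure, ‖(θ : L2Torus) x‖ = 1

/-- The subspace `θ H²(𝕋²) = {θ g : g ∈ H²(𝕋²)}` of `H²(𝕋²)`. (For inner `θ` the products `θ g`
all lie in `H²(𝕋²)`.) -/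
def beurling (θ : H2) : Submodule ℂ H2 where
  carrier := {f | ∃ g : H2, (f : L2Torus) =ᵐ[torusMeasure]
    fun x => (θ : L2Torus) x * (g : L2Torus) x}
  add_mem' := by
    rintro f₁ f₂ ⟨g₁, h₁⟩ ⟨g₂, h₂⟩
    refine ⟨g₁ + g₂, ?_⟩
    filter_upwards [h₁, h₂, Lp.coeFn_add (f₁ : L2Torus) f₂, Lp.coeFn_add (g₁ : L2Torus) g₂]
      with x a b c d
    simp only [Submodule.coe_add]
    rw [c, d, Pi.add_apply, Pi.add_apply, a, b, mul_add]
  zero_mem' := ⟨0, by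
    filter_upwards [Lp.coeFn_zero ℂ 2 torusMeasure] with x hx
    simp only [Submodule.coe_zero]
    rw [hx]
    simp⟩
  smul_mem' := by
    rintro a f ⟨g, h⟩
    refine ⟨a • g, ?_⟩
    filter_upwards [h, Lp.coeFn_smul a (f : L2Torus), Lp.coeFn_smul a (g : L2Torus)] with x p q r
    simp only [Submodule.coe_smul]
    rw [q, r, Pi.smul_apply, Pi.smul_apply, p, smul_eq_mul, smul_eq_mul, mul_left_comm]

/-- The compression `P_K S|_K` of an operator `S` on `H²(𝕋²)` to `K = H²(𝕋²) ⊖ M`. For `S = S_z`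
and `S = S_w` these form the two-variable Jordan block on `K`. -/
def compression (S : H2 →L[ℂ] H2) (M : Submodule ℂ H2) : Mᗮ →L[ℂ] Mᗮ :=
  Mᗮ.orthogonalProjectionOnto ∘L S ∘L Mᗮ.subtypeL

end Hardy

/-- Similarity `(T₁, T₂, φ) ≅ (V₁, V₂, f)`: for some bounded invertible `L : H → K` one has
`L T₁ L⁻¹ = V₁`, `L T₂ L⁻¹ = V₂` and `L φ = f`. -/
def Similar {H K : Type*} [NormedAddCommGroup H] [InnerProductSpace ℂ H]
    [NormedAddCommGroup K] [InnerProductSpace ℂ K]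
    (T₁ T₂ : H →L[ℂ] H) (φ : H) (V₁ V₂ : K →L[ℂ] K) (f : K) : Prop :=
  ∃ L : H ≃L[ℂ] K,
    (L : H →L[ℂ] K) ∘L T₁ ∘L (L.symm : K →L[ℂ] H) = V₁ ∧
    (L : H →L[ℂ] K) ∘L T₂ ∘L (L.symm : K →L[ℂ] H) = V₂ ∧
    L φ = f

/-- `θ` is an inner function, `θ H²(𝕋²)` is a proper subspace of `H²(𝕋²)`, and `(T₁, T₂, φ)` is
similar to `(S_{K_z}, S_{K_w}, P_K 1)`, where `K = H²(𝕋²) ⊖ θ H²(𝕋²)`. -/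
def IsBeurlingModel {H : Type*} [NormedAddCommGroup H] [InnerProductSpace ℂ H]
    (T₁ T₂ : H →L[ℂ] H) (φ : H) (θ : H2) : Prop :=
  IsInner θ ∧ beurling θ ≠ ⊤ ∧
    Similar T₁ T₂ φ (compression Sz (beurling θ)) (compression Sw (beurling θ))
      ((beurling θ)ᗮ.orthogonalProjectionOnto one)

end BidiscFrames

end

noncomputable section

namespace BidiscFrames

/-! ### Wandering vectors of doubly commuting pure isometries. -/

section Wandering

variable {E : Type*} [NormedAddCommGroup E] [InnerProductSpace ℂ E]

/-! Identify `ell2 (ℕ × ℕ)` with `H2` through the monomials z^i w^j; then `R₁`, `R₂` become `Sz`,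
`Sw`. For a frame the synthesis operator is a bounded surjection U from `H2` to H that sends z^i w^j
to T₁^i T₂^j φ and intertwines the shifts with T₁, T₂. Restricted to the orthogonal complement of
ker U it is invertible, and its inverse is a similarity with the compressed shifts
(`similar_of_intertwining`). Overcompleteness says that ker U is nonzero, so it remains to show that
ker U is generated by an inner function.

This is `DoublyCommuteOn.exists_isInner`, a Beurling theorem. On the kernel the shifts are doubly
commuting pure isometries, so the shifts of the wandering vectors in ker A₁* ∩ ker A₂* are total
(`eq_zero_of_orthogonal_wandering`). A unit wandering vector θ is orthogonal to its own shifts,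
which makes |θ|² a function without nonconstant Fourier terms, hence |θ| = 1
(`isInner_of_inner_shift`). A wandering η orthogonal to θ gives θ̄η = 0, hence η = 0
(`eq_zero_of_inner_shift`). The wandering space is thus a line, and the kernel is θH².

Conversely, a similarity L turns the projection P onto K into a surjection L⁻¹P that maps the
orthonormal monomials to the orbit; so the orbit is a frame, and θ itself supplies a nontrivial
relation. Every model ψ satisfies ψH² = ker U, and two inner generators of the same subspace differ
by a function which lies in `H2` together with its conjugate, that is, by a constant. -/

theorem commute_apply {A B : E →L[ℂ] E} (h : Commute A B) (x : E) : A (B x) = B (A x) :=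
  congrArg (fun T : E →L[ℂ] E => T x) h.eq

theorem norm_pow_apply {V : E →L[ℂ] E} (hV : ∀ x, ‖V x‖ = ‖x‖) (n : ℕ) (x : E) :
    ‖(V ^ n) x‖ = ‖x‖ := by
  induction n generalizing x with
  | zero => simp
  | succ n ih => rw [pow_succ, mul_apply_eq_comp, ih, hV]

/-- A pure isometry: an isometry without nonzero unitary part. -/
def IsPureIsometry (V : E →L[ℂ] E) : Prop :=
  (∀ x, ‖V x‖ = ‖x‖) ∧ ∀ x, (∀ n : ℕ, ∃ y, x = (V ^ n) y) → x = 0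

variable [CompleteSpace E]

theorem IsPureIsometry.star_mul_self {V : E →L[ℂ] E} (hV : IsPureIsometry V) :
    star V * V = 1 :=
  (ContinuousLinearMap.norm_map_iff_adjoint_comp_self V).1 hV.1

theorem IsPureIsometry.star_apply_apply {V : E →L[ℂ] E} (hV : IsPureIsometry V) (x : E) :
    star V (V x) = x :=
  congrArg (fun T : E →L[ℂ] E => T x) hV.star_mul_self

/-- By induction x = V^n V*^n x, so x lies in the range of every power of V. -/
theorem IsPureIsometry.eq_zero {V : E →L[ℂ] E} (hV : IsPureIsometry V) {x : E}
    (h : ∀ n : ℕ, ((star V) ^ n) x = V (star V (((star V) ^ n) x))) : x = 0 := by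
  refine hV.2 x fun n => ⟨((star V) ^ n) x, ?_⟩
  induction n with
  | zero => simp
  | succ n ih =>
    rw [pow_succ V, pow_succ' (star V), mul_apply_eq_comp,
      mul_apply_eq_comp, ← h n]
    exact ih

theorem inner_star_left (V : E →L[ℂ] E) (x y : E) :
    inner ℂ (star V x) y = inner ℂ x (V y) :=
  ContinuousLinearMap.adjoint_inner_left V y x

theorem inner_star_right (V : E →L[ℂ] E) (x y : E) :
    inner ℂ x (star V y) = inner ℂ (V x) y :=
  ContinuousLinearMap.adjoint_inner_right V x y

variable {V₁ V₂ : E →L[ℂ] E}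

/-- A vector orthogonal to all shifts of the wandering subspace `ker V₁* ∩ ker V₂*` of a doubly
commuting pair of pure isometries vanishes. -/
theorem eq_zero_of_orthogonal_wandering (hd : DoublyCommute V₁ V₂) (h₁ : IsPureIsometry V₁)
    (h₂ : IsPureIsometry V₂) {x : E}
    (hx : ∀ w, star V₁ w = 0 → star V₂ w = 0 → ∀ i j : ℕ,
      inner ℂ ((V₁ ^ i) ((V₂ ^ j) w)) x = 0) : x = 0 := by
  have c12 : Commute V₁ V₂ := hd.1
  have c1s2 : Commute V₁ (star V₂) := hd.2
  have cs12 : Commute (star V₁) V₂ := by simpa using c1s2.star_star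
  have cs1s2 : Commute (star V₁) (star V₂) := c12.star_star
  have key : ∀ i j : ℕ, ∀ u y : E, y = ((star V₁) ^ i) (((star V₂) ^ j) x) →
      u = y - V₂ (star V₂ y) → u = V₁ (star V₁ u) := by
    intro i j u y hy hu
    set w := u - V₁ (star V₁ u) with hw
    have w1 : star V₁ w = 0 := by rw [hw, map_sub, h₁.star_apply_apply, sub_self]
    have u2 : star V₂ u = 0 := by rw [hu, map_sub, h₂.star_apply_apply, sub_self]
    have w2 : star V₂ w = 0 := by
      rw [hw, map_sub, ← commute_apply c1s2, ← commute_apply cs1s2, u2]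
      simp
    have hwy : inner ℂ w y = 0 := by
      have h := hx w w1 w2 i j
      rw [← inner_star_right (V₁ ^ i), star_pow] at h
      rw [← inner_star_right (V₂ ^ j), star_pow] at h
      rwa [hy, commute_apply (cs1s2.pow_pow i j)]
    have hwu : inner ℂ w u = 0 := by
      rw [hu, inner_sub_right, hwy, ← inner_star_left, w2, inner_zero_left, sub_zero]
    have hww : inner ℂ w w = 0 := by
      conv_lhs => rw [hw]
      rw [← hw, inner_sub_right, hwu, ← inner_star_left, w1, inner_zero_left, sub_zero]
    exact sub_eq_zero.1 (inner_self_eq_zero.1 hww)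
  -- Purity is used twice: for V₂ on x, then for V₁ on each defect (1 - V₂V₂*)V₂*^j x.
  refine h₂.eq_zero fun j => ?_
  rw [← sub_eq_zero]
  refine h₁.eq_zero fun i => ?_
  refine key i j _ _ rfl ?_
  rw [map_sub, commute_apply (cs12.pow_left i), commute_apply (cs1s2.pow_left i)]

theorem inner_pow_pow {V : E →L[ℂ] E} (hV : ∀ x, ‖V x‖ = ‖x‖) (n : ℕ) (x y : E) :
    inner ℂ ((V ^ n) x) ((V ^ n) y) = inner ℂ x y := by
  rw [← inner_star_right (V ^ n)]
  congr 1
  exact congrArg (fun T : E →L[ℂ] E => T y)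
    ((ContinuousLinearMap.norm_map_iff_adjoint_comp_self (V ^ n)).1 (norm_pow_apply hV n))

/-- Cancelling A^i leaves B^j w against a vector in the range of A. Since A* commutes with B, B^j w
stays in ker A*. -/
theorem inner_shift_eq_zero_of_lt {A B : E →L[ℂ] E} (hA : ∀ x, ‖A x‖ = ‖x‖)
    (hAB : Commute (star A) B) {w : E} (hw : star A w = 0) {i k : ℕ} (hik : i < k) (j : ℕ)
    (v : E) : inner ℂ ((A ^ i) ((B ^ j) w)) ((A ^ k) v) = 0 := by
  obtain ⟨d, rfl⟩ := Nat.exists_eq_add_of_lt hik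
  rw [add_assoc, pow_add, mul_apply_eq_comp, inner_pow_pow hA, pow_succ',
    mul_apply_eq_comp, ← inner_star_left, commute_apply (hAB.pow_right j), hw,
    map_zero, inner_zero_left]

/-- Distinct shifts of wandering vectors are orthogonal. -/
theorem inner_shift_eq_zero (hd : DoublyCommute V₁ V₂) (h₁ : ∀ x, ‖V₁ x‖ = ‖x‖)
    (h₂ : ∀ x, ‖V₂ x‖ = ‖x‖) {w v : E} (hw₁ : star V₁ w = 0) (hw₂ : star V₂ w = 0)
    (hv₁ : star V₁ v = 0) (hv₂ : star V₂ v = 0) {i j k l : ℕ} (h : ¬(i = k ∧ j = l)) :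
    inner ℂ ((V₁ ^ i) ((V₂ ^ j) w)) ((V₁ ^ k) ((V₂ ^ l) v)) = 0 := by
  have c12 : Commute V₁ V₂ := hd.1
  have cs21 : Commute (star V₂) V₁ := hd.2.symm
  have cs12 : Commute (star V₁) V₂ := by simpa using cs21.symm.star_star
  rcases lt_trichotomy i k with hik | hik | hik
  · exact inner_shift_eq_zero_of_lt h₁ cs12 hw₁ hik _ _
  · rcases lt_trichotomy j l with hjl | hjl | hjl
    · rw [commute_apply (c12.pow_pow i j), commute_apply (c12.pow_pow k l)]
      exact inner_shift_eq_zero_of_lt h₂ cs21 hw₂ hjl _ _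
    · exact absurd ⟨hik, hjl⟩ h
    · rw [commute_apply (c12.pow_pow i j), commute_apply (c12.pow_pow k l),
        inner_eq_zero_symm]
      exact inner_shift_eq_zero_of_lt h₂ cs21 hv₂ hjl _ _
  · rw [inner_eq_zero_symm]
    exact inner_shift_eq_zero_of_lt h₁ cs12 hv₁ hik _ _

end Wandering

/-! ### Frames and their synthesis operators. -/

section FrameOperators

variable {ι H : Type*} [NormedAddCommGroup H] [InnerProductSpace ℂ H]

theorem hasSum_smul_of_apply_single [DecidableEq ι] {f : ι → H} {U : ell2 ι →L[ℂ] H}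
    (hU : ∀ i, U (lp.single 2 i 1) = f i) (c : ell2 ι) :
    HasSum (fun i => c i • f i) (U c) := by
  have h := U.hasSum (lp.hasSum_single (p := 2) (by simp) c)
  convert h using 2 with i
  rw [← hU i, ← map_smul]
  refine congrArg U ((lp.single_smul (E := fun _ : ι => ℂ) 2 i (c i) (1 : ℂ)).symm.trans ?_)
  exact congrArg (lp.single (E := fun _ : ι => ℂ) 2 i) (mul_one (c i))

/-- A bounded U forces all the series to converge, so the partially defined operator has full domain
and its kernel is closed. -/
theorem synthesisKernel_eq_ker [DecidableEq ι] {f : ι → H} {U : ell2 ι →L[ℂ] H}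
    (hU : ∀ i, U (lp.single 2 i 1) = f i) :
    synthesisKernel f = U.ker := by
  ext c
  have hc := hasSum_smul_of_apply_single hU c
  constructor
  · rintro ⟨d, hd, rfl⟩
    exact hc.tsum_eq.symm.trans hd
  · intro h
    exact ⟨⟨c, hc.summable⟩, hc.tsum_eq.trans h, rfl⟩

theorem ker_ne_bot_iff_not_unique [DecidableEq ι] {f : ι → H} {U : ell2 ι →L[ℂ] H}
    (hU : ∀ i, U (lp.single 2 i 1) = f i) :
    (∃ (x : H) (c d : ell2 ι), c ≠ d ∧
      HasSum (fun i => c i • f i) x ∧ HasSum (fun i => d i • f i) x) ↔ ∃ c, c ≠ 0 ∧ U c = 0 := by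
  have hs := hasSum_smul_of_apply_single hU
  constructor
  · rintro ⟨x, c, d, hcd, hc, hd⟩
    refine ⟨c - d, sub_ne_zero.2 hcd, ?_⟩
    rw [map_sub, (hs c).unique hc, (hs d).unique hd, sub_self]
  · rintro ⟨c, hc, h⟩
    exact ⟨0, c, 0, hc, h ▸ hs c, by simp⟩

variable [CompleteSpace H]

/-- The synthesis operator of a frame is everywhere defined, bounded and onto. -/
theorem IsFrame.exists_synthesis [DecidableEq ι] {f : ι → H} (hf : IsFrame f) :
    ∃ U : ell2 ι →L[ℂ] H, (∀ i, U (lp.single 2 i 1) = f i) ∧ Function.Surjective U := by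
  obtain ⟨C₁, C₂, h1, h12, hf⟩ := hf
  have hp : (2 : ℝ≥0∞).toReal = 2 := by norm_num
  have hmem : ∀ x : H, Memℓp (fun i => (inner ℂ (f i) x : ℂ)) 2 := fun x => by
    refine memℓp_gen ?_
    simpa [hp] using (hf x).1
  let A₀ : H →ₗ[ℂ] ell2 ι :=
    { toFun := fun x => ⟨fun i => inner ℂ (f i) x, hmem x⟩
      map_add' := fun x y => by ext i; exact inner_add_right _ _ _
      map_smul' := fun a x => by ext i; exact inner_smul_right _ _ _ }
  have hA₀ : ∀ x, ‖A₀ x‖ ^ 2 = ∑' i, ‖inner ℂ (f i) x‖ ^ 2 := fun x => by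
    have h := lp.norm_rpow_eq_tsum (p := 2) (by norm_num) (A₀ x)
    simp only [hp, Real.rpow_ofNat] at h
    exact h
  let A : H →L[ℂ] ell2 ι := A₀.mkContinuous (Real.sqrt C₂) fun x => by
    refine le_of_sq_le_sq ?_ (by positivity)
    rw [hA₀, mul_pow, Real.sq_sqrt (h1.le.trans h12)]
    exact (hf x).2.2
  have hA : ∀ x, ‖A x‖ ^ 2 = ∑' i, ‖inner ℂ (f i) x‖ ^ 2 := hA₀
  refine ⟨ContinuousLinearMap.adjoint A, fun i => ?_, ?_⟩
  · refine ext_inner_right ℂ fun x => ?_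
    rw [ContinuousLinearMap.adjoint_inner_left, lp.inner_single_left]
    change inner ℂ (1 : ℂ) (inner ℂ (f i) x) = _
    simp
  -- A is the analysis operator. The lower frame bound makes A*A coercive, hence invertible
  -- (Lax–Milgram), so A* is onto.
  · have hu : IsUnit (ContinuousLinearMap.adjoint A ∘L A) := by
      refine ContinuousLinearMap.isUnit_of_forall_le_norm_inner_map _ (c := ⟨C₁, h1.le⟩) h1
        fun x => ?_
      rw [ContinuousLinearMap.comp_apply, ContinuousLinearMap.adjoint_inner_left,
        inner_self_eq_norm_sq_to_K]
      simp only [norm_pow, RCLike.norm_ofReal, abs_norm]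
      rw [hA, mul_comm]
      exact (hf x).2.1
    have := ((ContinuousLinearMap.isUnit_iff_bijective).1 hu).2
    intro y
    obtain ⟨x, hx⟩ := this y
    exact ⟨A x, hx⟩

/-- The image of a Hilbert basis under a bounded operator with a bounded right inverse is a
frame. -/
theorem isFrame_of_rightInverse {K : Type*} [NormedAddCommGroup K] [InnerProductSpace ℂ K]
    [CompleteSpace K] (b : HilbertBasis ι ℂ K) (G : K →L[ℂ] H) (R : H →L[ℂ] K)
    (hGR : ∀ x, G (R x) = x) : IsFrame fun i => G (b i) := by
  have hsum : ∀ x, HasSum (fun i => ‖inner ℂ (G (b i)) x‖ ^ 2)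
      (‖ContinuousLinearMap.adjoint G x‖ ^ 2) := fun x => by
    have h := lp.hasSum_norm (p := 2) (by norm_num) (b.repr (ContinuousLinearMap.adjoint G x))
    simp only [ENNReal.toReal_ofNat, Real.rpow_ofNat, LinearIsometryEquiv.norm_map,
      HilbertBasis.repr_apply_apply, ContinuousLinearMap.adjoint_inner_right] at h
    exact h
  -- From x = G(Rx) follows ‖x‖² = ⟨G*x, Rx⟩. The `+ 1` keeps the constant positive when R = 0.
  have hlow : ∀ x, ‖x‖ ≤ (‖R‖ + 1) * ‖ContinuousLinearMap.adjoint G x‖ := fun x => by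
    rcases eq_or_ne x 0 with rfl | hx
    · simp
    have h : ‖x‖ * ‖x‖ ≤ ‖ContinuousLinearMap.adjoint G x‖ * (‖R‖ * ‖x‖) := by
      calc ‖x‖ * ‖x‖ = ‖(inner ℂ x x : ℂ)‖ := by rw [inner_self_eq_norm_sq_to_K]; simp [sq]
        _ = ‖(inner ℂ (ContinuousLinearMap.adjoint G x) (R x) : ℂ)‖ := by
            rw [ContinuousLinearMap.adjoint_inner_left, hGR]
        _ ≤ _ := (norm_inner_le_norm _ _).trans
            (mul_le_mul_of_nonneg_left (R.le_opNorm x) (norm_nonneg _))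
    have h' : ‖x‖ ≤ ‖ContinuousLinearMap.adjoint G x‖ * ‖R‖ :=
      le_of_mul_le_mul_right (by linarith) (norm_pos_iff.2 hx)
    nlinarith [norm_nonneg (ContinuousLinearMap.adjoint G x)]
  have hpos : 0 < (‖R‖ + 1) ^ 2 := by positivity
  -- The maximum secures C₁ ≤ C₂, which the norm of G* alone would not do if H is trivial.
  refine ⟨((‖R‖ + 1) ^ 2)⁻¹, max ((‖R‖ + 1) ^ 2)⁻¹ (‖ContinuousLinearMap.adjoint G‖ ^ 2),
    by positivity, le_max_left _ _, fun x => ⟨(hsum x).summable, ?_, ?_⟩⟩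
  · rw [(hsum x).tsum_eq, inv_mul_le_iff₀ hpos, ← mul_pow]
    exact pow_le_pow_left₀ (norm_nonneg _) (hlow x) 2
  · rw [(hsum x).tsum_eq]
    refine (pow_le_pow_left₀ (norm_nonneg _)
      ((ContinuousLinearMap.adjoint G).le_opNorm x) 2).trans ?_
    rw [mul_pow]
    exact mul_le_mul_of_nonneg_right (le_max_right _ _) (by positivity)

end FrameOperators

end BidiscFrames

end

noncomputable section

namespace BidiscFrames

/-! ### The monomial basis of the Hardy space. -/

section HardyBasis

/-- The frequency of the monomial `zⁱ wʲ`. -/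
def freq (p : ℕ × ℕ) : Fin 2 → ℤ := ![p.1, p.2]

theorem freq_injective : Function.Injective freq := by
  intro p q h
  have h0 := congrFun h 0
  have h1 := congrFun h 1
  simp only [freq, Matrix.cons_val_zero, Matrix.cons_val_one, Nat.cast_inj] at h0 h1
  exact Prod.ext h0 h1

theorem exists_freq_eq {n : Fin 2 → ℤ} (h : ¬(n 0 < 0 ∨ n 1 < 0)) : ∃ p, freq p = n := by
  rw [not_or, not_lt, not_lt] at h
  refine ⟨((n 0).toNat, (n 1).toNat), ?_⟩
  ext i
  fin_cases i
  · simpa [freq] using h.1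
  · simpa [freq] using h.2

theorem mFourierBasis_freq_mem (p : ℕ × ℕ) :
    (mFourierBasis (d := Fin 2) (freq p) : L2Torus) ∈ hardy := by
  intro n hn
  rw [← fourierBasis_repr, HilbertBasis.repr_apply_apply,
    orthonormal_iff_ite.1 (mFourierBasis (d := Fin 2)).orthonormal, if_neg]
  rintro rfl
  simp only [freq, Matrix.cons_val_zero, Matrix.cons_val_one] at hn
  omega

theorem eq_zero_of_coeff_freq {f : H2}
    (h : ∀ p, mFourierCoeff (f : L2Torus) (freq p) = 0) : f = 0 := by
  refine Subtype.ext ((mFourierBasis (d := Fin 2)).repr.injective (lp.ext (funext fun n => ?_)))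
  rw [fourierBasis_repr]
  refine Eq.trans ?_ (congrArg (fun u => u n) (map_zero (mFourierBasis (d := Fin 2)).repr)).symm
  by_cases hn : n 0 < 0 ∨ n 1 < 0
  · exact f.2 n hn
  · obtain ⟨p, rfl⟩ := exists_freq_eq hn
    exact h p

theorem orthonormal_freq : Orthonormal ℂ
    fun p => (⟨mFourierBasis (d := Fin 2) (freq p), mFourierBasis_freq_mem p⟩ : H2) := by
  have h := (mFourierBasis (d := Fin 2)).orthonormal.comp freq freq_injective
  exact ⟨h.1, h.2⟩

/-- The Hilbert basis `zⁱ wʲ` of `H²(𝕋²)`. -/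
def hardyBasis : HilbertBasis (ℕ × ℕ) ℂ H2 :=
  HilbertBasis.mkOfOrthogonalEqBot orthonormal_freq <| by
    refine (Submodule.eq_bot_iff _).2 fun f hf => eq_zero_of_coeff_freq fun p => ?_
    rw [← fourierBasis_repr, HilbertBasis.repr_apply_apply]
    exact (Submodule.mem_orthogonal _ _).1 hf _ (Submodule.subset_span ⟨p, rfl⟩)

theorem coe_hardyBasis (p : ℕ × ℕ) :
    (hardyBasis p : L2Torus) = mFourierBasis (d := Fin 2) (freq p) :=
  congrArg Subtype.val (congrFun (HilbertBasis.coe_mkOfOrthogonalEqBot orthonormal_freq _) p)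

theorem coeFn_hardyBasis (p : ℕ × ℕ) :
    (hardyBasis p : L2Torus) =ᵐ[torusMeasure] mFourier (freq p) := by
  rw [coe_hardyBasis, coe_mFourierBasis]
  exact coeFn_mFourierLp 2 _

theorem hardyBasis_repr (f : H2) (p : ℕ × ℕ) :
    hardyBasis.repr f p = mFourierCoeff (f : L2Torus) (freq p) := by
  rw [HilbertBasis.repr_apply_apply, ← fourierBasis_repr, HilbertBasis.repr_apply_apply,
    ← coe_hardyBasis]
  rfl

theorem hardyBasis_zero : hardyBasis (0, 0) = one := by
  refine Subtype.ext (Lp.ext ?_)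
  filter_upwards [coeFn_hardyBasis (0, 0), Lp.coeFn_const 2 torusMeasure (1 : ℂ)] with x h1 h2
  have h3 : freq (0, 0) = 0 := by ext i; fin_cases i <;> rfl
  rw [h1, h3, mFourier_zero]
  exact h2.symm

/-- A bounded operator on `H²(𝕋²)` maps into a closed subspace as soon as it maps all monomials
into it. -/
theorem map_mem_of_hardyBasis {F : Type*} [NormedAddCommGroup F] [NormedSpace ℂ F]
    (T : H2 →L[ℂ] F) {M : Submodule ℂ F} (hM : IsClosed (M : Set F))
    (h : ∀ p, T (hardyBasis p) ∈ M) (f : H2) : T f ∈ M := by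
  have hc : IsClosed (M.comap (T : H2 →ₗ[ℂ] F) : Set H2) := hM.preimage T.continuous
  have hs : Submodule.span ℂ (Set.range hardyBasis) ≤ M.comap (T : H2 →ₗ[ℂ] F) := by
    rw [Submodule.span_le]
    rintro _ ⟨p, rfl⟩
    exact h p
  have := Submodule.topologicalClosure_minimal _ hs hc
  rw [hardyBasis.dense_span] at this
  exact this (Submodule.mem_top (x := f))

end HardyBasis

/-! ### Coordinate shifts as multiplication by the variables. -/

section ShiftIntertwining

theorem pushforward_apply {ι : Type*} (e : ι ↪ ι) (c : ell2 ι) (i : ι) :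
    pushforward e c (e i) = c i :=
  e.injective.extend_apply _ _ _

theorem pushforward_apply_of_forall_ne {ι : Type*} (e : ι ↪ ι) (c : ell2 ι) {i : ι}
    (h : ∀ j, e j ≠ i) : pushforward e c i = 0 :=
  Function.extend_apply' _ _ _ fun ⟨j, hj⟩ => h j hj

theorem R₁_apply_succ (c : ell2 (ℕ × ℕ)) (i j : ℕ) : R₁ c (i + 1, j) = c (i, j) :=
  pushforward_apply ⟨fun p : ℕ × ℕ => (p.1 + 1, p.2), _⟩ c (i, j)

theorem R₁_apply_zero (c : ell2 (ℕ × ℕ)) (j : ℕ) : R₁ c (0, j) = 0 :=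
  pushforward_apply_of_forall_ne _ c fun p h => by simpa using congrArg Prod.fst h

theorem R₂_apply_succ (c : ell2 (ℕ × ℕ)) (i j : ℕ) : R₂ c (i, j + 1) = c (i, j) :=
  pushforward_apply ⟨fun p : ℕ × ℕ => (p.1, p.2 + 1), _⟩ c (i, j)

theorem R₂_apply_zero (c : ell2 (ℕ × ℕ)) (i : ℕ) : R₂ c (i, 0) = 0 :=
  pushforward_apply_of_forall_ne _ c fun p h => by simpa using congrArg Prod.snd h

theorem norm_R₁ (c : ell2 (ℕ × ℕ)) : ‖R₁ c‖ = ‖c‖ := LinearIsometry.norm_map _ c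

theorem norm_R₂ (c : ell2 (ℕ × ℕ)) : ‖R₂ c‖ = ‖c‖ := LinearIsometry.norm_map _ c

theorem R₁_pow_apply_of_lt {n i : ℕ} (h : i < n) (c : ell2 (ℕ × ℕ)) (j : ℕ) :
    (R₁ ^ n) c (i, j) = 0 := by
  induction n generalizing i with
  | zero => omega
  | succ n ih =>
    rw [pow_succ', mul_apply_eq_comp]
    cases i with
    | zero => exact R₁_apply_zero _ _
    | succ i => exact (R₁_apply_succ _ _ _).trans (ih (by omega))

theorem R₂_pow_apply_of_lt {n j : ℕ} (h : j < n) (c : ell2 (ℕ × ℕ)) (i : ℕ) :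
    (R₂ ^ n) c (i, j) = 0 := by
  induction n generalizing j with
  | zero => omega
  | succ n ih =>
    rw [pow_succ', mul_apply_eq_comp]
    cases j with
    | zero => exact R₂_apply_zero _ _
    | succ j => exact (R₂_apply_succ _ _ _).trans (ih (by omega))

theorem restrict_pow_apply {E : Type*} [NormedAddCommGroup E] [NormedSpace ℂ E]
    (V : E →L[ℂ] E) {N : Submodule ℂ E} (h : ∀ x ∈ N, V x ∈ N) (n : ℕ) (x : N) :
    (((V.restrict h) ^ n) x : E) = (V ^ n) x := by
  induction n with
  | zero => rfl
  | succ n ih =>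
    rw [pow_succ', pow_succ', mul_apply_eq_comp, mul_apply_eq_comp, ← ih]
    rfl

/-- Vectors in the range of the n-th power vanish at all first indices below n. -/
theorem isPureIsometry_R₁_restrict {N : Submodule ℂ (ell2 (ℕ × ℕ))}
    (h : ∀ x ∈ N, R₁ x ∈ N) : IsPureIsometry (R₁.restrict h) := by
  refine ⟨fun x => norm_R₁ _, fun x hx => Subtype.ext (lp.ext (funext fun p => ?_))⟩
  obtain ⟨y, hy⟩ := hx (p.1 + 1)
  rw [hy, restrict_pow_apply]
  exact R₁_pow_apply_of_lt (Nat.lt_succ_self _) _ _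

theorem isPureIsometry_R₂_restrict {N : Submodule ℂ (ell2 (ℕ × ℕ))}
    (h : ∀ x ∈ N, R₂ x ∈ N) : IsPureIsometry (R₂.restrict h) := by
  refine ⟨fun x => norm_R₂ _, fun x hx => Subtype.ext (lp.ext (funext fun p => ?_))⟩
  obtain ⟨y, hy⟩ := hx (p.2 + 1)
  rw [hy, restrict_pow_apply]
  exact R₂_pow_apply_of_lt (Nat.lt_succ_self _) _ _

theorem R₁_single (p : ℕ × ℕ) :
    R₁ (lp.single 2 p 1) = lp.single 2 (p.1 + 1, p.2) 1 := by
  refine lp.ext (funext fun q => ?_)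
  obtain ⟨i, j⟩ := q
  cases i with
  | zero =>
    refine (R₁_apply_zero _ _).trans (lp.single_apply_ne (E := fun _ : ℕ × ℕ => ℂ) _ _ _ ?_).symm
    simp
  | succ i =>
    refine (R₁_apply_succ _ _ _).trans ?_
    simp [lp.single_apply, Pi.single_apply, Prod.ext_iff]

theorem R₂_single (p : ℕ × ℕ) :
    R₂ (lp.single 2 p 1) = lp.single 2 (p.1, p.2 + 1) 1 := by
  refine lp.ext (funext fun q => ?_)
  obtain ⟨i, j⟩ := q
  cases j with
  | zero =>
    refine (R₂_apply_zero _ _).trans (lp.single_apply_ne (E := fun _ : ℕ × ℕ => ℂ) _ _ _ ?_).symm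
    simp
  | succ j =>
    refine (R₂_apply_succ _ _ _).trans ?_
    simp [lp.single_apply, Pi.single_apply, Prod.ext_iff]

theorem hardyBasis_repr_Sz (f : H2) : hardyBasis.repr (Sz f) = R₁ (hardyBasis.repr f) := by
  refine lp.ext (funext fun q => ?_)
  obtain ⟨i, j⟩ := q
  have h : hardyBasis.repr (Sz f) (i, j) =
      mFourierCoeff (f : L2Torus) (freq (i, j) - Pi.single 0 1) :=
    (hardyBasis_repr _ _).trans (mFourierCoeff_mulMonomial _ _ _)
  cases i with
  | zero =>
    refine h.trans ((f.2 _ (Or.inl ?_)).trans (R₁_apply_zero _ _).symm)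
    simp [freq]
  | succ i =>
    rw [h]
    refine Eq.trans ?_ ((R₁_apply_succ _ _ _).trans (hardyBasis_repr _ _)).symm
    congr 1
    ext k
    fin_cases k <;> simp [freq]

theorem hardyBasis_repr_Sw (f : H2) : hardyBasis.repr (Sw f) = R₂ (hardyBasis.repr f) := by
  refine lp.ext (funext fun q => ?_)
  obtain ⟨i, j⟩ := q
  have h : hardyBasis.repr (Sw f) (i, j) =
      mFourierCoeff (f : L2Torus) (freq (i, j) - Pi.single 1 1) :=
    (hardyBasis_repr _ _).trans (mFourierCoeff_mulMonomial _ _ _)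
  cases j with
  | zero =>
    refine h.trans ((f.2 _ (Or.inr ?_)).trans (R₂_apply_zero _ _).symm)
    simp [freq]
  | succ j =>
    rw [h]
    refine Eq.trans ?_ ((R₂_apply_succ _ _ _).trans (hardyBasis_repr _ _)).symm
    congr 1
    ext k
    fin_cases k <;> simp [freq]

theorem hardyBasis_repr_Sz_pow_Sw_pow (i j : ℕ) (f : H2) :
    hardyBasis.repr ((Sz ^ i) ((Sw ^ j) f)) = (R₁ ^ i) ((R₂ ^ j) (hardyBasis.repr f)) := by
  induction i with
  | zero =>
    induction j with
    | zero => rfl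
    | succ j ih =>
      rw [pow_succ', pow_succ' R₂, mul_apply_eq_comp, mul_apply_eq_comp]
      exact (hardyBasis_repr_Sw _).trans (congrArg R₂ ih)
  | succ i ih =>
    rw [pow_succ', pow_succ' R₁, mul_apply_eq_comp, mul_apply_eq_comp, hardyBasis_repr_Sz, ih]

theorem R₁_pow_R₂_pow_single (i j : ℕ) :
    (R₁ ^ i) ((R₂ ^ j) (lp.single 2 (0, 0) 1)) = lp.single 2 (i, j) 1 := by
  induction i with
  | zero =>
    induction j with
    | zero => rfl
    | succ j ih =>
      rw [pow_succ', mul_apply_eq_comp]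
      exact (congrArg R₂ ih).trans (R₂_single _)
  | succ i ih =>
    rw [pow_succ', mul_apply_eq_comp, ih, R₁_single]

theorem Sz_pow_Sw_pow_one (i j : ℕ) : (Sz ^ i) ((Sw ^ j) one) = hardyBasis (i, j) := by
  refine hardyBasis.repr.injective ?_
  rw [hardyBasis_repr_Sz_pow_Sw_pow, ← hardyBasis_zero, HilbertBasis.repr_self,
    HilbertBasis.repr_self]
  convert R₁_pow_R₂_pow_single i j

theorem coeFn_Sz_pow_Sw_pow (i j : ℕ) (f : H2) :
    ((Sz ^ i) ((Sw ^ j) f) : L2Torus) =ᵐ[torusMeasure]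
      fun x => mFourier (freq (i, j)) x * (f : L2Torus) x := by
  induction i with
  | zero =>
    induction j with
    | zero =>
      have h3 : freq (0, 0) = 0 := by ext i; fin_cases i <;> rfl
      rw [h3, mFourier_zero]
      exact Filter.Eventually.of_forall fun x => (one_mul _).symm
    | succ j ih =>
      have h := coeFn_mulMonomial (Pi.single 1 1) ((Sz ^ 0) ((Sw ^ j) f) : L2Torus)
      rw [pow_succ']
      filter_upwards [h, ih] with x h1 h2
      refine h1.trans ?_
      rw [h2, ← mul_assoc, ← mFourier_add]
      congr 3
      ext k
      fin_cases k <;> simp [freq, add_comm]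
  | succ i ih =>
    have h := coeFn_mulMonomial (Pi.single 0 1) ((Sz ^ i) ((Sw ^ j) f) : L2Torus)
    rw [pow_succ']
    filter_upwards [h, ih] with x h1 h2
    refine h1.trans ?_
    rw [h2, ← mul_assoc, ← mFourier_add]
    congr 3
    ext k
    fin_cases k <;> simp [freq, add_comm]

end ShiftIntertwining

end BidiscFrames

end

noncomputable section

namespace BidiscFrames

/-! ### Inner functions and the subspaces they generate. -/

section InnerFunctions

open ComplexConjugate

theorem memLp_mul_of_norm_eq_one {u : Torus2 → ℂ} (hu : AEStronglyMeasurable u torusMeasure)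
    (h : ∀ᵐ x ∂torusMeasure, ‖u x‖ = 1) (g : L2Torus) :
    MemLp (fun x => u x * g x) 2 torusMeasure := by
  refine (Lp.memLp g).congr_norm (hu.mul (Lp.aestronglyMeasurable g)) ?_
  filter_upwards [h] with x hx
  rw [norm_mul, hx, one_mul]

/-- Multiplication by an inner function on `L²(𝕋²)`. -/
def innerMul (θ : H2) (hθ : IsInner θ) : L2Torus →ₗᵢ[ℂ] L2Torus where
  toFun g := (memLp_mul_of_norm_eq_one (Lp.aestronglyMeasurable (θ : L2Torus)) hθ g).toLp _
  map_add' f g := by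
    rw [← MemLp.toLp_add, MemLp.toLp_eq_toLp_iff]
    filter_upwards [Lp.coeFn_add f g] with x hx
    rw [hx]
    exact mul_add _ _ _
  map_smul' a f := by
    rw [RingHom.id_apply, ← MemLp.toLp_const_smul, MemLp.toLp_eq_toLp_iff]
    filter_upwards [Lp.coeFn_smul a f] with x hx
    rw [hx]
    exact mul_left_comm _ _ _
  norm_map' g := by
    refine (Lp.norm_toLp _ (memLp_mul_of_norm_eq_one
      (Lp.aestronglyMeasurable (θ : L2Torus)) hθ g)).trans ?_
    rw [Lp.norm_def]
    congr 1
    refine eLpNorm_congr_norm_ae ?_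
    filter_upwards [hθ] with x hx
    rw [norm_mul, hx, one_mul]

theorem coeFn_innerMul (θ : H2) (hθ : IsInner θ) (g : L2Torus) :
    innerMul θ hθ g =ᵐ[torusMeasure] fun x => (θ : L2Torus) x * g x :=
  MemLp.coeFn_toLp (memLp_mul_of_norm_eq_one (Lp.aestronglyMeasurable (θ : L2Torus)) hθ g)

theorem innerMul_hardyBasis (θ : H2) (hθ : IsInner θ) (p : ℕ × ℕ) :
    innerMul θ hθ (hardyBasis p : L2Torus) = ((Sz ^ p.1) ((Sw ^ p.2) θ) : L2Torus) := by
  refine Lp.ext ?_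
  filter_upwards [coeFn_innerMul θ hθ (hardyBasis p), coeFn_Sz_pow_Sw_pow p.1 p.2 θ,
    coeFn_hardyBasis p] with x h1 h2 h3
  rw [h1, h2, h3, mul_comm]

/-- On monomials the product is a shift of θ, hence in the closed space `hardy`; the monomials are
total. -/
theorem innerMul_mem_hardy (θ : H2) (hθ : IsInner θ) (f : H2) :
    innerMul θ hθ (f : L2Torus) ∈ hardy :=
  map_mem_of_hardyBasis ((innerMul θ hθ).toContinuousLinearMap ∘L hardy.subtypeL) isClosed_hardy
    (fun p => by
      change innerMul θ hθ (hardyBasis p : L2Torus) ∈ hardy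
      rw [innerMul_hardyBasis]
      exact Subtype.mem _) f

/-- Multiplication by an inner function on `H²(𝕋²)`. -/
def innerMulHardy (θ : H2) (hθ : IsInner θ) : H2 →ₗᵢ[ℂ] H2 where
  toFun f := ⟨innerMul θ hθ f, innerMul_mem_hardy θ hθ f⟩
  map_add' f g := Subtype.ext (map_add (innerMul θ hθ) (f : L2Torus) g)
  map_smul' a f := Subtype.ext (map_smul (innerMul θ hθ) a (f : L2Torus))
  norm_map' f := (innerMul θ hθ).norm_map (f : L2Torus)

theorem innerMulHardy_hardyBasis (θ : H2) (hθ : IsInner θ) (p : ℕ × ℕ) :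
    innerMulHardy θ hθ (hardyBasis p) = (Sz ^ p.1) ((Sw ^ p.2) θ) :=
  Subtype.ext (innerMul_hardyBasis θ hθ p)

theorem mem_beurling_iff {θ : H2} (hθ : IsInner θ) {f : H2} :
    f ∈ beurling θ ↔ ∃ g, innerMulHardy θ hθ g = f := by
  refine exists_congr fun g => ⟨fun h => Subtype.ext (Lp.ext ?_), ?_⟩
  · filter_upwards [h, coeFn_innerMul θ hθ g] with x h1 h2
    exact h2.trans h1.symm
  · rintro rfl
    exact coeFn_innerMul θ hθ g

theorem isClosed_beurling {θ : H2} (hθ : IsInner θ) : IsClosed (beurling θ : Set H2) := by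
  have h : (beurling θ : Set H2) = Set.range (innerMulHardy θ hθ) :=
    Set.ext fun f => mem_beurling_iff hθ
  rw [h]
  exact (innerMulHardy θ hθ).isometry.isClosedEmbedding.isClosed_range

theorem self_mem_beurling {θ : H2} : θ ∈ beurling θ := by
  refine ⟨one, ?_⟩
  filter_upwards [Lp.coeFn_const 2 torusMeasure (1 : ℂ)] with x h2
  refine (mul_one _).symm.trans ?_
  congr 1
  exact h2.symm

theorem IsInner.ne_zero {θ : H2} (hθ : IsInner θ) : θ ≠ 0 := by
  rintro rfl
  obtain ⟨x, h1, h2⟩ := (hθ.and (Lp.coeFn_zero ℂ 2 torusMeasure)).exists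
  have h3 : ((0 : H2) : L2Torus) x = 0 := h2
  rw [h3, norm_zero] at h1
  exact zero_ne_one h1

theorem mFourierCoeff_eq_conj {g h : Torus2 → ℂ}
    (hgh : h =ᵐ[torusMeasure] fun x => conj (g x)) (n : Fin 2 → ℤ) :
    mFourierCoeff g n = conj (mFourierCoeff h (-n)) := by
  unfold mFourierCoeff
  rw [← integral_conj]
  refine integral_congr_ae ?_
  filter_upwards [hgh] with x hx
  rw [hx]
  simp only [smul_eq_mul, map_mul, RingHomCompTriple.comp_apply, RingHom.id_apply, ← mFourier_neg,
    neg_neg]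

/-- A function in `H²(𝕋²)` whose complex conjugate is in `H²(𝕋²)` is constant. -/
theorem eq_smul_one_of_conj_mem {g h : H2}
    (hgh : (h : L2Torus) =ᵐ[torusMeasure] fun x => conj ((g : L2Torus) x)) :
    ∃ c : ℂ, g = c • one := by
  refine ⟨hardyBasis.repr g (0, 0), ?_⟩
  have hs := hardyBasis.hasSum_repr g
  rw [← hardyBasis_zero]
  refine hs.unique (hasSum_single (0, 0) fun p hp => ?_)
  -- Conjugation reflects frequencies, and -p has a negative entry unless p = (0, 0).
  have h0 : hardyBasis.repr g p = 0 := by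
    rw [hardyBasis_repr, mFourierCoeff_eq_conj hgh, h.2, map_zero]
    simp only [freq, Pi.neg_apply, Matrix.cons_val_zero, Matrix.cons_val_one]
    by_contra hc
    refine hp (Prod.ext ?_ ?_) <;> simp only <;> omega
  rw [h0, zero_smul]

/-- The inner function generating a Beurling subspace is unique up to a unimodular constant. -/
theorem eq_smul_of_beurling_eq {θ ψ : H2} (hθ : IsInner θ) (hψ : IsInner ψ)
    (h : beurling ψ = beurling θ) : ∃ c : ℂ, ‖c‖ = 1 ∧ ψ = c • θ := by
  obtain ⟨g, hg⟩ : ψ ∈ beurling θ := h ▸ self_mem_beurling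
  obtain ⟨k, hk⟩ : θ ∈ beurling ψ := h ▸ self_mem_beurling
  -- Both gk = 1 and |g| = 1 hold almost everywhere, so k is the conjugate of g.
  have hgk : (k : L2Torus) =ᵐ[torusMeasure] fun x => conj ((g : L2Torus) x) := by
    filter_upwards [hg, hk, hθ, hψ] with x h1 h2 h3 h4
    have hg1 : ‖(g : L2Torus) x‖ = 1 := by
      have := congrArg norm h1
      rwa [norm_mul, h3, h4, one_mul, eq_comm] at this
    have hθ0 : (θ : L2Torus) x ≠ 0 := norm_ne_zero_iff.1 (by rw [h3]; exact one_ne_zero)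
    have h5 : (g : L2Torus) x * (k : L2Torus) x = 1 := by
      refine mul_left_cancel₀ hθ0 ?_
      rw [← mul_assoc, ← h1, ← h2, mul_one]
    have h6 : (g : L2Torus) x * conj ((g : L2Torus) x) = 1 := by
      rw [Complex.mul_conj']
      simp [hg1]
    exact mul_left_cancel₀ (left_ne_zero_of_mul_eq_one h5) (h5.trans h6.symm)
  obtain ⟨c, rfl⟩ := eq_smul_one_of_conj_mem hgk
  have hψθ : ψ = c • θ := by
    refine Subtype.ext (Lp.ext ?_)
    filter_upwards [hg, Lp.coeFn_const 2 torusMeasure (1 : ℂ),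
      Lp.coeFn_smul c (one : L2Torus), Lp.coeFn_smul c (θ : L2Torus)] with x h1 h2 h3 h4
    rw [h1, Submodule.coe_smul, Submodule.coe_smul, h3, h4, Pi.smul_apply, Pi.smul_apply]
    have h5 : (one : L2Torus) x = 1 := h2
    rw [h5, smul_eq_mul, smul_eq_mul, mul_one, mul_comm]
  refine ⟨c, ?_, hψθ⟩
  obtain ⟨x, h1, h2, h3⟩ := (hθ.and (hψ.and (Lp.coeFn_smul c (θ : L2Torus)))).exists
  rw [hψθ, Submodule.coe_smul, h3, Pi.smul_apply, norm_smul, h1, mul_one] at h2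
  exact h2

/-- Trigonometric polynomials are uniformly dense in the continuous functions, and these determine a
finite measure. -/
theorem measure_eq_of_integral_mFourier_eq {μ ν : Measure Torus2} [IsFiniteMeasure μ]
    [IsFiniteMeasure ν] (h : ∀ n : Fin 2 → ℤ, ∫ x, mFourier n x ∂μ = ∫ x, mFourier n x ∂ν) :
    μ = ν := by
  have key : ∀ g : C(Torus2, ℂ), ∫ x, g x ∂μ = ∫ x, g x ∂ν := by
    intro g
    have hint : ∀ (ρ : Measure Torus2) [IsFiniteMeasure ρ] (f : C(Torus2, ℂ)),
        Integrable f ρ := fun ρ _ f =>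
      Integrable.of_bound f.continuous.aestronglyMeasurable ‖f‖
        (Filter.Eventually.of_forall f.norm_coe_le_norm)
    have hcont : ∀ (ρ : Measure Torus2) [IsFiniteMeasure ρ],
        Continuous fun f : C(Torus2, ℂ) => ∫ x, f x ∂ρ := fun ρ _ => by
      have h2 : (fun f : C(Torus2, ℂ) => ∫ x, f x ∂ρ) =
          fun f => ∫ x, (ContinuousMap.toLp 1 ρ ℂ f : Torus2 → ℂ) x ∂ρ := by
        funext f
        exact (integral_congr_ae (ContinuousMap.coeFn_toLp ρ f)).symm
      rw [h2]
      exact continuous_integral.comp (ContinuousMap.toLp 1 ρ ℂ).continuous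
    let S : Submodule ℂ C(Torus2, ℂ) :=
      { carrier := {f | ∫ x, f x ∂μ = ∫ x, f x ∂ν}
        add_mem' := fun {f g} hf hg => by
          simp only [Set.mem_ofPred_eq, ContinuousMap.add_apply] at hf hg ⊢
          rw [integral_add (hint _ _) (hint _ _), integral_add (hint _ _) (hint _ _), hf, hg]
        zero_mem' := by simp
        smul_mem' := fun a f hf => by
          simp only [Set.mem_ofPred_eq, ContinuousMap.smul_apply] at hf ⊢
          rw [integral_smul, integral_smul, hf] }
    have hS : IsClosed (S : Set C(Torus2, ℂ)) := isClosed_eq (hcont μ) (hcont ν)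
    have hle : Submodule.span ℂ (Set.range (mFourier (d := Fin 2))) ≤ S := by
      rw [Submodule.span_le]
      rintro _ ⟨n, rfl⟩
      exact h n
    have htop := Submodule.topologicalClosure_minimal _ hle hS
    rw [span_mFourier_closure_eq_top] at htop
    exact htop (Submodule.mem_top (x := g))
  refine ext_of_forall_integral_eq_of_IsFiniteMeasure fun f => ?_
  have h1 := key ⟨fun x => (f x : ℂ), by fun_prop⟩
  simp only [ContinuousMap.coe_mk] at h1
  rw [integral_complex_ofReal, integral_complex_ofReal] at h1
  exact_mod_cast h1

/-- Fourier coefficients of `f̄ g`. -/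
theorem inner_shift_hardy (f g : H2) (i j k l : ℕ) :
    inner ℂ ((Sz ^ i) ((Sw ^ j) f)) ((Sz ^ k) ((Sw ^ l) g)) =
      ∫ x, mFourier (freq (k, l) - freq (i, j)) x *
        (conj ((f : L2Torus) x) * (g : L2Torus) x) ∂torusMeasure := by
  refine (L2.inner_def (𝕜 := ℂ) _ _).trans (integral_congr_ae ?_)
  filter_upwards [coeFn_Sz_pow_Sw_pow i j f, coeFn_Sz_pow_Sw_pow k l g] with x h1 h2
  refine (RCLike.inner_apply (𝕜 := ℂ) _ _).trans
    ((congrArg₂ (fun a b => a * conj b) h2 h1).trans ?_)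
  rw [sub_eq_add_neg, mFourier_add, mFourier_neg, map_mul]
  ring

/-- Positive and negative parts. Hence inner products of shifts within `H2` reach every Fourier
coefficient of f̄g, including negative and mixed frequencies. -/
theorem exists_freq_sub (n : Fin 2 → ℤ) : ∃ i j k l : ℕ, freq (k, l) - freq (i, j) = n := by
  refine ⟨(-(n 0)).toNat, (-(n 1)).toNat, (n 0).toNat, (n 1).toNat, ?_⟩
  ext a
  fin_cases a
  · simp only [freq, Pi.sub_apply, Matrix.cons_val_zero, Fin.zero_eta]; omega
  · simp only [freq, Pi.sub_apply, Matrix.cons_val_one, Fin.mk_one, Matrix.cons_val_zero]; omega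

/-- A unit vector in `H²(𝕋²)` which is orthogonal to its shifts is inner. -/
theorem isInner_of_inner_shift {θ : H2} (h1 : ‖θ‖ = 1)
    (h : ∀ i j k l : ℕ, ¬(i = k ∧ j = l) →
      inner ℂ ((Sz ^ i) ((Sw ^ j) θ)) ((Sz ^ k) ((Sw ^ l) θ)) = 0) : IsInner θ := by
  have hm : AEMeasurable (fun x => ‖(θ : L2Torus) x‖ₑ ^ 2) torusMeasure :=
    (Lp.aestronglyMeasurable (θ : L2Torus)).enorm.pow_const 2
  have hfin : ∫⁻ x, ‖(θ : L2Torus) x‖ₑ ^ 2 ∂torusMeasure ≠ ∞ := by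
    have := (Lp.memLp (θ : L2Torus)).2
    have h2 := lintegral_rpow_enorm_lt_top_of_eLpNorm_lt_top (by norm_num) (by norm_num) this
    simp only [ENNReal.toReal_ofNat, ENNReal.rpow_ofNat] at h2
    exact h2.ne
  have : IsFiniteMeasure (torusMeasure.withDensity fun x => ‖(θ : L2Torus) x‖ₑ ^ 2) :=
    isFiniteMeasure_withDensity hfin
  -- The measure |θ|²dμ has the Fourier coefficients of Haar measure: off frequency zero by
  -- orthogonality of the shifts, at zero because ‖θ‖ = 1.
  have hμ : (torusMeasure.withDensity fun x => ‖(θ : L2Torus) x‖ₑ ^ 2) = torusMeasure := by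
    refine measure_eq_of_integral_mFourier_eq fun n => ?_
    rw [integral_withDensity_eq_integral_toReal_smul₀ hm (ae_of_all _ fun x => by simp)]
    have e1 : ∀ x, (‖(θ : L2Torus) x‖ₑ ^ 2).toReal • mFourier n x =
        mFourier n x * (conj ((θ : L2Torus) x) * (θ : L2Torus) x) := fun x => by
      rw [Complex.conj_mul', ENNReal.toReal_pow, toReal_enorm, Complex.real_smul, mul_comm]
      push_cast
      rfl
    simp only [e1]
    obtain ⟨i, j, k, l, rfl⟩ := exists_freq_sub n
    rw [← inner_shift_hardy]
    have h3 := inner_shift_hardy one one i j k l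
    rw [Sz_pow_Sw_pow_one, Sz_pow_Sw_pow_one,
      orthonormal_iff_ite.1 hardyBasis.orthonormal] at h3
    have h4 : ∫ x, mFourier (freq (k, l) - freq (i, j)) x ∂torusMeasure =
        if (i, j) = (k, l) then 1 else 0 := by
      rw [h3]
      refine integral_congr_ae ?_
      filter_upwards [Lp.coeFn_const 2 torusMeasure (1 : ℂ)] with x hx
      have h5 : (one : L2Torus) x = 1 := hx
      rw [h5, map_one, mul_one, mul_one]
    rw [h4]
    split_ifs with hc
    · obtain ⟨rfl, rfl⟩ := Prod.mk_inj.1 hc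
      have h6 : ‖(Sz ^ i) ((Sw ^ j) θ)‖ = 1 := by
        rw [← hardyBasis.repr.norm_map, hardyBasis_repr_Sz_pow_Sw_pow, norm_pow_apply norm_R₁,
          norm_pow_apply norm_R₂, hardyBasis.repr.norm_map, h1]
      refine (inner_self_eq_norm_sq_to_K (𝕜 := ℂ) (E := H2) _).trans ?_
      rw [h6]
      simp
    · exact h i j k l fun hc' => hc (Prod.ext hc'.1 hc'.2)
  have hone := (withDensity_eq_iff hm (measurable_one.aemeasurable) hfin).1
    (hμ.trans withDensity_one.symm)
  filter_upwards [hone] with x hx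
  have h2 := congrArg ENNReal.toReal hx
  rw [ENNReal.toReal_pow, toReal_enorm] at h2
  exact (pow_eq_one_iff_of_nonneg (norm_nonneg _) two_ne_zero).1 (h2.trans (by simp))

/-- A vector in `H²(𝕋²)` all of whose shifts are orthogonal to all shifts of an inner function
vanishes. -/
theorem eq_zero_of_inner_shift {θ η : H2} (hθ : IsInner θ)
    (h : ∀ i j k l : ℕ, inner ℂ ((Sz ^ i) ((Sw ^ j) θ)) ((Sz ^ k) ((Sw ^ l) η)) = 0) : η = 0 := by
  have hu : AEStronglyMeasurable (fun x => conj ((θ : L2Torus) x)) torusMeasure :=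
    Complex.continuous_conj.comp_aestronglyMeasurable (Lp.aestronglyMeasurable _)
  have hn : ∀ᵐ x ∂torusMeasure, ‖conj ((θ : L2Torus) x)‖ = 1 := by
    filter_upwards [hθ] with x hx
    rw [RCLike.norm_conj, hx]
  have hm := memLp_mul_of_norm_eq_one hu hn (η : L2Torus)
  -- The hypothesis says that all Fourier coefficients of θ̄η vanish.
  have h0 : hm.toLp _ = 0 := by
    refine (mFourierBasis (d := Fin 2)).repr.injective (lp.ext (funext fun n => ?_))
    rw [map_zero]
    refine (fourierBasis_repr (hm.toLp _) n).trans ?_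
    obtain ⟨i, j, k, l, hijkl⟩ := exists_freq_sub (-n)
    have h1 := h i j k l
    rw [inner_shift_hardy, hijkl] at h1
    refine Eq.trans (integral_congr_ae ?_) h1
    filter_upwards [hm.coeFn_toLp] with x hx
    rw [hx, smul_eq_mul]
  refine Subtype.ext (Lp.ext ?_)
  have h2 : (hm.toLp _ : Torus2 → ℂ) =ᵐ[torusMeasure] 0 := by
    rw [h0]; exact Lp.coeFn_zero _ _ _
  filter_upwards [hθ, h2, hm.coeFn_toLp, Lp.coeFn_zero ℂ 2 torusMeasure] with x h3 h4 h5 h6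
  rw [h5] at h4
  have h7 : conj ((θ : L2Torus) x) ≠ 0 :=
    norm_ne_zero_iff.1 (by rw [RCLike.norm_conj, h3]; exact one_ne_zero)
  exact ((mul_eq_zero.1 h4).resolve_left h7).trans h6.symm

end InnerFunctions

end BidiscFrames

end

noncomputable section

namespace BidiscFrames

/-! ### The Beurling theorem for doubly commuting shifts. -/

section BeurlingMandrekar

theorem inner_sub_inner_smul_self {E : Type*} [NormedAddCommGroup E] [InnerProductSpace ℂ E]
    {w : E} (hw : ‖w‖ = 1) (v : E) : inner ℂ w (v - (inner ℂ w v : ℂ) • w) = 0 := by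
  rw [inner_sub_right, inner_smul_right, inner_self_eq_norm_sq_to_K, hw]
  simp

/-- Beurling's theorem on the torus: a nonzero closed shift invariant subspace on which the shifts
doubly commute is generated by an inner function. -/
theorem DoublyCommuteOn.exists_isInner {N : Submodule ℂ (ell2 (ℕ × ℕ))}
    (hd : DoublyCommuteOn R₁ R₂ N) (hN : ∃ c ∈ N.topologicalClosure, c ≠ 0) :
    ∃ θ : H2, IsInner θ ∧
      ∀ f : H2, f ∈ beurling θ ↔ hardyBasis.repr f ∈ N.topologicalClosure := by
  obtain ⟨m₁, m₂, hd⟩ := hd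
  set M := N.topologicalClosure with hM
  set V₁ := R₁.restrict m₁
  set V₂ := R₂.restrict m₂
  have p₁ : IsPureIsometry V₁ := isPureIsometry_R₁_restrict m₁
  have p₂ : IsPureIsometry V₂ := isPureIsometry_R₂_restrict m₂
  have hV : ∀ (i j : ℕ) (x : M), (((V₁ ^ i) ((V₂ ^ j) x) : M) : ell2 (ℕ × ℕ)) =
      (R₁ ^ i) ((R₂ ^ j) x) := fun i j x => by
    rw [restrict_pow_apply, restrict_pow_apply]
  -- If no unit wandering vector existed, the orthogonality condition would be void and the subspace
  -- zero.
  obtain ⟨w, hw₁, hw₂, hw⟩ : ∃ w : M, star V₁ w = 0 ∧ star V₂ w = 0 ∧ ‖w‖ = 1 := by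
    by_contra hcon
    obtain ⟨c, hc, hc0⟩ := hN
    refine hc0 (congrArg Subtype.val (eq_zero_of_orthogonal_wandering hd p₁ p₂ (x := ⟨c, hc⟩)
      fun v hv₁ hv₂ i j => ?_))
    have hv : v = 0 := by
      by_contra hv0
      refine hcon ⟨((‖v‖⁻¹ : ℝ) : ℂ) • v, by rw [map_smul, hv₁, smul_zero],
        by rw [map_smul, hv₂, smul_zero], ?_⟩
      rw [norm_smul, Complex.norm_real, norm_inv, norm_norm,
        inv_mul_cancel₀ (norm_ne_zero_iff.2 hv0)]
    rw [hv, map_zero, map_zero, inner_zero_left]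
  have hin : ∀ (x y : M) (i j k l : ℕ),
      inner ℂ ((Sz ^ i) ((Sw ^ j) (hardyBasis.repr.symm x)))
        ((Sz ^ k) ((Sw ^ l) (hardyBasis.repr.symm y))) =
      inner ℂ ((V₁ ^ i) ((V₂ ^ j) x)) ((V₁ ^ k) ((V₂ ^ l) y)) := fun x y i j k l => by
    refine (hardyBasis.repr.inner_map_map _ _).symm.trans ?_
    rw [hardyBasis_repr_Sz_pow_Sw_pow, hardyBasis_repr_Sz_pow_Sw_pow,
      LinearIsometryEquiv.apply_symm_apply, LinearIsometryEquiv.apply_symm_apply, ← hV, ← hV]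
    rfl
  have hθ : IsInner (hardyBasis.repr.symm w) := by
    refine isInner_of_inner_shift ?_ fun i j k l h => ?_
    · exact (hardyBasis.repr.symm.norm_map _).trans hw
    · rw [hin]
      exact inner_shift_eq_zero hd p₁.1 p₂.1 hw₁ hw₂ hw₁ hw₂ h
  set θ := hardyBasis.repr.symm w with hθw
  -- The wandering space is a line: the part of v orthogonal to w is wandering, so all its shifts
  -- are orthogonal to all shifts of w.
  have hspan : ∀ v : M, star V₁ v = 0 → star V₂ v = 0 → v = (inner ℂ w v : ℂ) • w := by
    intro v hv₁ hv₂
    rw [← sub_eq_zero]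
    set u := v - (inner ℂ w v : ℂ) • w with hu
    have hu₁ : star V₁ u = 0 := by rw [hu, map_sub, map_smul, hw₁, hv₁, smul_zero, sub_zero]
    have hu₂ : star V₂ u = 0 := by rw [hu, map_sub, map_smul, hw₂, hv₂, smul_zero, sub_zero]
    have hη : hardyBasis.repr.symm (u : ell2 (ℕ × ℕ)) = 0 := by
      refine eq_zero_of_inner_shift hθ fun i j k l => ?_
      rw [hθw, hin]
      by_cases h : i = k ∧ j = l
      · obtain ⟨rfl, rfl⟩ := h
        rw [inner_pow_pow p₁.1, inner_pow_pow p₂.1, hu]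
        exact inner_sub_inner_smul_self hw v
      · exact inner_shift_eq_zero hd p₁.1 p₂.1 hw₁ hw₂ hu₁ hu₂ h
    exact Subtype.ext ((map_eq_zero_iff _ hardyBasis.repr.symm.injective).1 hη)
  have hle : ∀ f ∈ beurling θ, hardyBasis.repr f ∈ M := by
    intro f hf
    obtain ⟨g, rfl⟩ := (mem_beurling_iff hθ).1 hf
    refine map_mem_of_hardyBasis ((hardyBasis.repr : H2 →L[ℂ] ell2 (ℕ × ℕ)) ∘L
      (innerMulHardy θ hθ).toContinuousLinearMap) N.isClosed_topologicalClosure (fun p => ?_) g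
    change hardyBasis.repr (innerMulHardy θ hθ (hardyBasis p)) ∈ M
    rw [innerMulHardy_hardyBasis, hardyBasis_repr_Sz_pow_Sw_pow, hθw,
      LinearIsometryEquiv.apply_symm_apply, ← hV]
    exact Subtype.mem _
  refine ⟨θ, hθ, fun f => ⟨hle f, fun hf => ?_⟩⟩
  have : CompleteSpace (beurling θ) := (isClosed_beurling hθ).completeSpace_coe
  obtain ⟨a, ha, b, hb, rfl⟩ := (beurling θ).exists_add_mem_mem_orthogonal f
  have hbM : hardyBasis.repr b ∈ M := by
    rw [map_add] at hf
    exact (Submodule.add_mem_iff_right _ (hle a ha)).1 hf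
  -- The component b is orthogonal to θH², hence to all shifts of w, and by `hspan` to those of
  -- every wandering vector.
  have hb0 : (⟨hardyBasis.repr b, hbM⟩ : M) = 0 := by
    refine eq_zero_of_orthogonal_wandering hd p₁ p₂ fun v hv₁ hv₂ i j => ?_
    rw [hspan v hv₁ hv₂, map_smul, map_smul, inner_smul_left]
    have h1 : inner ℂ (innerMulHardy θ hθ (hardyBasis (i, j))) b = 0 :=
      (Submodule.mem_orthogonal _ _).1 hb _ ((mem_beurling_iff hθ).2 ⟨_, rfl⟩)
    rw [innerMulHardy_hardyBasis] at h1
    have h2 : inner ℂ ((V₁ ^ i) ((V₂ ^ j) w)) (⟨hardyBasis.repr b, hbM⟩ : M) = 0 := by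
      refine Eq.trans ?_ ((hardyBasis.repr.inner_map_map _ _).trans h1)
      rw [hardyBasis_repr_Sz_pow_Sw_pow, hθw, LinearIsometryEquiv.apply_symm_apply, ← hV]
      rfl
    rw [h2, mul_zero]
  have hb0' : b = 0 :=
    (map_eq_zero_iff _ hardyBasis.repr.injective).1 (congrArg Subtype.val hb0)
  rw [hb0', add_zero]
  exact ha

end BeurlingMandrekar

/-! ### Similarity with compressed shifts. -/

section Models

theorem apply_eq_of_hardyBasis {F : Type*} [AddCommMonoid F] [Module ℂ F] [TopologicalSpace F]
    [T2Space F] {A B : H2 →L[ℂ] F} (h : ∀ p, A (hardyBasis p) = B (hardyBasis p)) (f : H2) :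
    A f = B f := by
  have hd : Dense (Submodule.span ℂ (Set.range hardyBasis) : Set H2) :=
    Submodule.dense_iff_topologicalClosure_eq_top.2 hardyBasis.dense_span
  refine DFunLike.congr_fun (ContinuousLinearMap.ext_on hd ?_) f
  rintro _ ⟨p, rfl⟩
  exact h p

theorem exists_continuousLinearEquiv_of_bijective {K H : Type*} [NormedAddCommGroup K]
    [InnerProductSpace ℂ K] [CompleteSpace K] [NormedAddCommGroup H] [InnerProductSpace ℂ H]
    [CompleteSpace H]
    (W : K →L[ℂ] H) (hW : Function.Bijective W) : ∃ L : K ≃L[ℂ] H, ∀ x, L x = W x :=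
  ⟨ContinuousLinearEquiv.ofBijective W (LinearMap.ker_eq_bot.2 hW.1)
    (LinearMap.range_eq_top.2 hW.2), fun _ => rfl⟩

theorem innerMulHardy_Sz {θ : H2} (hθ : IsInner θ) (f : H2) :
    innerMulHardy θ hθ (Sz f) = Sz (innerMulHardy θ hθ f) := by
  refine Subtype.ext (Lp.ext ?_)
  filter_upwards [coeFn_innerMul θ hθ (Sz f), coeFn_innerMul θ hθ f,
    coeFn_mulMonomial (Pi.single 0 1) f,
    coeFn_mulMonomial (Pi.single 0 1) (innerMul θ hθ f)] with x h1 h2 h3 h4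
  refine h1.trans (Eq.trans ?_ h4.symm)
  rw [h2, mul_left_comm]
  exact congrArg _ h3

theorem innerMulHardy_Sw {θ : H2} (hθ : IsInner θ) (f : H2) :
    innerMulHardy θ hθ (Sw f) = Sw (innerMulHardy θ hθ f) := by
  refine Subtype.ext (Lp.ext ?_)
  filter_upwards [coeFn_innerMul θ hθ (Sw f), coeFn_innerMul θ hθ f,
    coeFn_mulMonomial (Pi.single 1 1) f,
    coeFn_mulMonomial (Pi.single 1 1) (innerMul θ hθ f)] with x h1 h2 h3 h4
  refine h1.trans (Eq.trans ?_ h4.symm)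
  rw [h2, mul_left_comm]
  exact congrArg _ h3

theorem Sz_mem_beurling {θ : H2} (hθ : IsInner θ) : ∀ f ∈ beurling θ, Sz f ∈ beurling θ := by
  intro f hf
  obtain ⟨g, rfl⟩ := (mem_beurling_iff hθ).1 hf
  exact (mem_beurling_iff hθ).2 ⟨Sz g, innerMulHardy_Sz hθ g⟩

theorem Sw_mem_beurling {θ : H2} (hθ : IsInner θ) : ∀ f ∈ beurling θ, Sw f ∈ beurling θ := by
  intro f hf
  obtain ⟨g, rfl⟩ := (mem_beurling_iff hθ).1 hf
  exact (mem_beurling_iff hθ).2 ⟨Sw g, innerMulHardy_Sw hθ g⟩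

theorem sub_orthogonalProjectionOnto_orthogonal_mem {M : Submodule ℂ H2}
    (hM : IsClosed (M : Set H2)) (f : H2) : f - Mᗮ.orthogonalProjectionOnto f ∈ M := by
  have : CompleteSpace M := hM.completeSpace_coe
  have h := Submodule.sub_starProjection_mem_orthogonal (K := Mᗮ) f
  rwa [Submodule.orthogonal_orthogonal] at h

theorem orthogonalProjectionOnto_orthogonal_eq_zero_iff {M : Submodule ℂ H2}
    (hM : IsClosed (M : Set H2)) (f : H2) : Mᗮ.orthogonalProjectionOnto f = 0 ↔ f ∈ M := by
  have : CompleteSpace M := hM.completeSpace_coe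
  rw [Submodule.orthogonalProjectionOnto_eq_zero_iff, Submodule.orthogonal_orthogonal]

/-- The difference f - Pf lies in M and S preserves M, so PSPf = PSf. -/
theorem compression_orthogonalProjectionOnto {S : H2 →L[ℂ] H2} {M : Submodule ℂ H2}
    (hM : IsClosed (M : Set H2)) (hS : ∀ f ∈ M, S f ∈ M) (f : H2) :
    compression S M (Mᗮ.orthogonalProjectionOnto f) = Mᗮ.orthogonalProjectionOnto (S f) := by
  have h := (orthogonalProjectionOnto_orthogonal_eq_zero_iff hM _).2
    (hS _ (sub_orthogonalProjectionOnto_orthogonal_mem hM f))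
  rw [map_sub, map_sub, sub_eq_zero] at h
  exact h.symm

variable {H : Type*} [NormedAddCommGroup H] [InnerProductSpace ℂ H]

theorem IsBeurlingModel.exists_equiv {T₁ T₂ : H →L[ℂ] H} {φ : H} {θ : H2}
    (h : IsBeurlingModel T₁ T₂ φ θ) : ∃ L : H ≃L[ℂ] ((beurling θ)ᗮ : Submodule ℂ H2),
      ∀ p, L (orbit T₁ T₂ φ p) = (beurling θ)ᗮ.orthogonalProjectionOnto (hardyBasis p) := by
  obtain ⟨hθ, -, L, h₁, h₂, hφ⟩ := h
  have hL₁ : ∀ x, L (T₁ x) = compression Sz (beurling θ) (L x) := fun x => by simp [← h₁]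
  have hL₂ : ∀ x, L (T₂ x) = compression Sw (beurling θ) (L x) := fun x => by simp [← h₂]
  have hc := isClosed_beurling hθ
  refine ⟨L, fun ⟨i, j⟩ => ?_⟩
  rw [← Sz_pow_Sw_pow_one]
  change L ((T₁ ^ i) ((T₂ ^ j) φ)) = _
  induction i with
  | zero =>
    induction j with
    | zero => exact hφ
    | succ j ih =>
      rw [pow_succ' T₂, pow_succ' Sw, mul_apply_eq_comp, mul_apply_eq_comp]
      refine (hL₂ _).trans ((congrArg _ ih).trans ?_)
      exact compression_orthogonalProjectionOnto hc (Sw_mem_beurling hθ) _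
  | succ i ih =>
    rw [pow_succ' T₁, pow_succ' Sz, mul_apply_eq_comp, mul_apply_eq_comp, hL₁, ih]
    exact compression_orthogonalProjectionOnto hc (Sz_mem_beurling hθ) _

/-- LU and the projection P agree on monomials, so ker U = ker P = θH². As U depends on T₁, T₂, φ
alone, this drives uniqueness. -/
theorem IsBeurlingModel.mem_beurling_iff {T₁ T₂ : H →L[ℂ] H} {φ : H} {θ : H2}
    (h : IsBeurlingModel T₁ T₂ φ θ) {U : H2 →L[ℂ] H}
    (hU : ∀ p, U (hardyBasis p) = orbit T₁ T₂ φ p) (f : H2) :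
    f ∈ beurling θ ↔ U f = 0 := by
  obtain ⟨L, hL⟩ := h.exists_equiv
  have hd : L (U f) = (beurling θ)ᗮ.orthogonalProjectionOnto f :=
    apply_eq_of_hardyBasis
      (A := (L : H →L[ℂ] ((beurling θ)ᗮ : Submodule ℂ H2)) ∘L U)
      (fun p => (congrArg L (hU p)).trans (hL p)) f
  rw [← orthogonalProjectionOnto_orthogonal_eq_zero_iff (isClosed_beurling h.1), ← hd]
  exact map_eq_zero_iff L L.injective

variable [CompleteSpace H]

theorem IsBeurlingModel.isOvercompleteFrame {T₁ T₂ : H →L[ℂ] H} {φ : H} {θ : H2}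
    (h : IsBeurlingModel T₁ T₂ φ θ) : IsOvercompleteFrame (orbit T₁ T₂ φ) := by
  obtain ⟨L, hL⟩ := h.exists_equiv
  let G : H2 →L[ℂ] H := (L.symm : _ →L[ℂ] H) ∘L (beurling θ)ᗮ.orthogonalProjectionOnto
  have hG : ∀ p, G (hardyBasis p) = orbit T₁ T₂ φ p := fun p =>
    (congrArg L.symm (hL p).symm).trans (L.symm_apply_apply _)
  refine ⟨?_, ?_⟩
  · have := isFrame_of_rightInverse hardyBasis G ((beurling θ)ᗮ.subtypeL ∘L (L : H →L[ℂ] _))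
      fun x => by
        change L.symm ((beurling θ)ᗮ.orthogonalProjectionOnto ((L x : _) : H2)) = x
        rw [Submodule.orthogonalProjectionOnto_mem_subspace_eq_self, L.symm_apply_apply]
    rwa [funext hG] at this
  · classical
    -- The coefficients of θ itself form a nonzero relation.
    refine (ker_ne_bot_iff_not_unique
      (U := G ∘L (hardyBasis.repr.symm : ell2 (ℕ × ℕ) →L[ℂ] H2)) fun p => ?_).2
      ⟨hardyBasis.repr θ, ?_, ?_⟩
    · change G (hardyBasis.repr.symm _) = _
      rw [HilbertBasis.repr_symm_single, hG]
    · rw [Ne, map_eq_zero_iff _ hardyBasis.repr.injective]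
      exact h.1.ne_zero
    · change G (hardyBasis.repr.symm (hardyBasis.repr θ)) = 0
      rw [LinearIsometryEquiv.symm_apply_apply]
      exact (h.mem_beurling_iff hG θ).1 self_mem_beurling

/-- A bounded operator from `H²(𝕋²)` onto `H` which intertwines the shifts with `T₁, T₂` induces
a similarity with the compressions of the shifts to the complement of its kernel. -/
theorem similar_of_intertwining {T₁ T₂ : H →L[ℂ] H} {φ : H} {U : H2 →L[ℂ] H}
    (hU : Function.Surjective U) {M : Submodule ℂ H2} (hM : ∀ f, f ∈ M ↔ U f = 0)
    (h₁ : ∀ f, U (Sz f) = T₁ (U f)) (h₂ : ∀ f, U (Sw f) = T₂ (U f)) (hφ : U one = φ) :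
    Similar T₁ T₂ φ (compression Sz M) (compression Sw M)
      (Mᗮ.orthogonalProjectionOnto one) := by
  have hMc : IsClosed (M : Set H2) := by
    have : (M : Set H2) = U ⁻¹' {0} := Set.ext hM
    rw [this]
    exact isClosed_singleton.preimage U.continuous
  have hP : ∀ f, U (Mᗮ.orthogonalProjectionOnto f : H2) = U f := fun f => by
    have h := (hM _).1 (sub_orthogonalProjectionOnto_orthogonal_mem hMc f)
    rw [map_sub, sub_eq_zero] at h
    exact h.symm
  let W : Mᗮ →L[ℂ] H := U ∘L Mᗮ.subtypeL
  have hinj : Function.Injective W := by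
    refine (injective_iff_map_eq_zero W).2 fun x hx => Subtype.ext ?_
    exact inner_self_eq_zero.1 ((Submodule.mem_orthogonal _ _).1 x.2 _ ((hM _).2 hx))
  have hsurj : Function.Surjective W := fun y => by
    obtain ⟨f, rfl⟩ := hU y
    exact ⟨Mᗮ.orthogonalProjectionOnto f, hP f⟩
  obtain ⟨L, hL⟩ := exists_continuousLinearEquiv_of_bijective (K := Mᗮ) W ⟨hinj, hsurj⟩
  replace hL : ∀ x, L x = U (x : H2) := hL
  refine ⟨L.symm, ?_, ?_, ?_⟩
  · ext1 x
    change L.symm (T₁ (L x)) = _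
    rw [ContinuousLinearEquiv.symm_apply_eq, hL, hL, ← h₁]
    exact (hP _).symm
  · ext1 x
    change L.symm (T₂ (L x)) = _
    rw [ContinuousLinearEquiv.symm_apply_eq, hL, hL, ← h₂]
    exact (hP _).symm
  · rw [ContinuousLinearEquiv.symm_apply_eq, hL, hP, hφ]

end Models

section ShiftsOfMonomials

theorem Sz_hardyBasis (i j : ℕ) : Sz (hardyBasis (i, j)) = hardyBasis (i + 1, j) := by
  rw [← Sz_pow_Sw_pow_one, ← Sz_pow_Sw_pow_one, pow_succ' Sz, mul_apply_eq_comp]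

theorem Sw_hardyBasis (i j : ℕ) : Sw (hardyBasis (i, j)) = hardyBasis (i, j + 1) := by
  classical
  refine hardyBasis.repr.injective ?_
  rw [hardyBasis_repr_Sw, HilbertBasis.repr_self, HilbertBasis.repr_self]
  convert R₂_single (i, j)

end ShiftsOfMonomials

end BidiscFrames

end

/-! ### The equivalence and the uniqueness of the inner function. -/

theorem mainTheorem2 {H : Type*} [NormedAddCommGroup H] [InnerProductSpace ℂ H]
    [CompleteSpace H] [TopologicalSpace.SeparableSpace H] (hH : ¬ FiniteDimensional ℂ H)
    (T₁ T₂ : H →L[ℂ] H) (hT : Commute T₁ T₂) (φ : H)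
    (hR : BidiscFrames.DoublyCommuteOn BidiscFrames.R₁ BidiscFrames.R₂
      (BidiscFrames.synthesisKernel (BidiscFrames.orbit T₁ T₂ φ))) :
    BidiscFrames.IsOvercompleteFrame (BidiscFrames.orbit T₁ T₂ φ) ↔
      ∃ θ : BidiscFrames.H2, BidiscFrames.IsBeurlingModel T₁ T₂ φ θ ∧
        ∀ ψ : BidiscFrames.H2, BidiscFrames.IsBeurlingModel T₁ T₂ φ ψ →
          ∃ c : ℂ, ‖c‖ = 1 ∧ ψ = c • θ := by
  classical
  refine ⟨fun ⟨hframe, hover⟩ => ?_, fun ⟨θ, hθ, _⟩ => hθ.isOvercompleteFrame⟩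
  obtain ⟨U₀, hU₀, hsurj⟩ := hframe.exists_synthesis
  have hker : ∀ c, c ∈ (BidiscFrames.synthesisKernel
      (BidiscFrames.orbit T₁ T₂ φ)).topologicalClosure ↔ U₀ c = 0 := fun c => by
    rw [BidiscFrames.synthesisKernel_eq_ker hU₀,
      IsClosed.submodule_topologicalClosure_eq U₀.isClosed_ker]
    exact LinearMap.mem_ker
  obtain ⟨c, hc0, hc⟩ := (BidiscFrames.ker_ne_bot_iff_not_unique hU₀).1 hover
  obtain ⟨θ, hθ, hmem⟩ := hR.exists_isInner ⟨c, (hker c).2 hc, hc0⟩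
  let U : BidiscFrames.H2 →L[ℂ] H :=
    U₀ ∘L (BidiscFrames.hardyBasis.repr : BidiscFrames.H2 →L[ℂ] BidiscFrames.ell2 (ℕ × ℕ))
  have hU : ∀ p, U (BidiscFrames.hardyBasis p) = BidiscFrames.orbit T₁ T₂ φ p := fun p => by
    change U₀ (BidiscFrames.hardyBasis.repr _) = _
    rw [HilbertBasis.repr_self, hU₀]
  have hUmem : ∀ f, f ∈ BidiscFrames.beurling θ ↔ U f = 0 := fun f =>
    (hmem f).trans (hker _)
  have hUsurj : Function.Surjective U := hsurj.comp BidiscFrames.hardyBasis.repr.surjective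
  refine ⟨θ, ⟨hθ, fun htop => hH ?_, ?_⟩, fun ψ hψ => ?_⟩
  -- If θH² were everything, the surjection U would vanish and H would be trivial.
  · have : Subsingleton H := by
      refine ⟨fun x y => ?_⟩
      obtain ⟨f, rfl⟩ := hUsurj x
      obtain ⟨g, rfl⟩ := hUsurj y
      rw [(hUmem f).1 (htop ▸ Submodule.mem_top), (hUmem g).1 (htop ▸ Submodule.mem_top)]
    infer_instance
  · refine BidiscFrames.similar_of_intertwining hUsurj hUmem
      (BidiscFrames.apply_eq_of_hardyBasis (A := U ∘L BidiscFrames.Sz)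
        (B := T₁ ∘L U) fun ⟨i, j⟩ => ?_)
      (BidiscFrames.apply_eq_of_hardyBasis (A := U ∘L BidiscFrames.Sw)
        (B := T₂ ∘L U) fun ⟨i, j⟩ => ?_) ?_
    · change U (BidiscFrames.Sz _) = T₁ (U _)
      rw [BidiscFrames.Sz_hardyBasis, hU, hU]
      exact congrArg (fun T : H →L[ℂ] H => T ((T₂ ^ j) φ)) (pow_succ' T₁ i)
    · change U (BidiscFrames.Sw _) = T₂ (U _)
      rw [BidiscFrames.Sw_hardyBasis, hU, hU]
      change (T₁ ^ i) ((T₂ ^ (j + 1)) φ) = T₂ ((T₁ ^ i) ((T₂ ^ j) φ))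
      rw [pow_succ' T₂, mul_apply_eq_comp]
      exact BidiscFrames.commute_apply (hT.pow_left i) _
    · rw [← BidiscFrames.hardyBasis_zero, hU]
      rfl
  -- Both subspaces equal ker U.
  · refine BidiscFrames.eq_smul_of_beurling_eq hθ hψ.1 (Submodule.ext fun f => ?_)
    rw [hψ.mem_beurling_iff hU, hUmem]
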